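/- \textbf{Setting.} Let $K\ge 2$ and $A,B,\tau>0$ with $KA\le B<1$ and $\tau\le (1-B)/K$. Let $(\mathcal A,\mathcal Q)$ be a probability space and, for each $u\in\mathcal A$, let $S_1(u),\dots,S_K(u)$ be similarities of $[0,1]$ into itself with scaling ratios $a(i,u)$, measurable in $u$, such that $A\le \min_i a(i,u)$, $\sum_i a(i,u)\le B$ and $\operatorname{dist}(S_i(u)[0,1],S_j(u)[0,1])\ge\tau$ for $i\ne j$. Let $\mathcal W=\{p\in\mathbb R^K: p_i\ge 0,\ \sum_i p_i=1\}$. Call a Borel probability measure $\mathcal R$ on $\mathcal W$ an \emph{independent weight distribution} if for some $t>0$ we have $\int p_i^{-t}\,d\mathcal R(p)<\infty$ for every $i$; call $p\in\mathcal W$ a \emph{valid weight vector} if $p_i\neq 0$ for all $i$ (equivalently, the point mass $\delta_p$ is an independent weight distribution). Given $\mathcal R$, draw $\lambda=(\lambda_n)_{n\ge1}$, $\lambda_n=(u_n,p^{(n)})$, i.i.d. with law $\mathcal Q\times\mathcal R$, and let $\mu_{\mathcal R}=\mu_\lambda$ be the random Borel probability measure on $[0,1]$ determined by $$\mu_\lambda\big(S_{i_1}(u_1)\circ\cdots\circ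 S_{i_n}(u_n)[0,1]\big)=p^{(1)}_{i_1}\cdots p^{(n)}_{i_n}\qquad\text{for all } n \text{ and all } i_1,\dots,i_n\in\{1,\dots,K\}.$$ Write $\mu_p$ for $\mu_{\delta_p}$. Let $\Phi:(0,1)\to[0,\infty)$ be such that $t^{1+\Phi(t)}$ decreases to $0$ as $t\downarrow0$ and is doubling near $0$ (there are $T,C>0$ with $(2t)^{1+\Phi(2t)}\le C\,t^{1+\Phi(t)}$ for $0<t<T$), and suppose $\Phi$ is \emph{large}: $\Phi(t)=H(t)\,\frac{\log|\log t|}{|\log t|}$ for small $t$, with $H(t)\to\infty$ as $t\to0$. The upper $\Phi$-dimension $\overline{\dim}_\Phi\mu$ is the infimum of all $d\in\mathbb R$ for which there are $C_1,C_2>0$, $C_1<1$, with $$\frac{\mu(B(x,\rho))}{\mu(B(x,r))}\le C_2\Big(\frac{\rho}{r}\Big)^d\quad\text{for all } x\in\operatorname{supp}\mu \text{ and all } 0<r<\rho^{1+\Phi(\rho)}\le\rho\le C_1,$$ and the lower $\Phi$-dimension $\underline{\dim}_\Phi\mu$ is the supremum of all $d$ for which this holds with $\ge$ in place of $\le$ (both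 as extended real numbers). \textbf{Theorem.} For every independent weight distribution $\mathcal R$ the dimensions $\overline{\dim}_\Phi\mu_{\mathcal R}$ and $\underline{\dim}_\Phi\mu_{\mathcal R}$ are almost surely constant; below they denote these constants. Put $$d=\inf_{\mathcal R}\overline{\dim}_\Phi\mu_{\mathcal R},\qquad d'=\sup_{\mathcal R}\underline{\dim}_\Phi\mu_{\mathcal R},$$ over all independent weight distributions $\mathcal R$. Then $d'<\infty$ and: \begin{itemize} \item for every real $t\ge d$ there is a single valid weight vector $p$ with $\overline{\dim}_\Phi\mu_p=t$ almost surely; \item for every real $t'$ with $0<t'\le d'$ there is a single valid weight vector $p$ with $\underline{\dim}_\Phi\mu_p=t'$ almost surely. \end{itemize} In particular, the set of almost sure values of $\overline{\dim}_\Phi\mu_{\mathcal R}$ attained by independent weight distributions is exactly $[d,\infty)$, and that of $\underline{\dim}_\Phi\mu_{\mathcal R}$ is exactly $(0,d']$. -/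

import Mathlib

open MeasureTheory Filter Topology Set
open scoped ENNReal unitInterval

noncomputable section

namespace RandomMoran

/-! ### Dimension functions and the `Φ`-dimensions of a measure -/

/-- `Φ : (0,1) → [0,∞)` is a dimension function: `t ^ (1 + Φ t)` decreases to `0` as `t` decreases
to `0` and is doubling near `0`. Values of `Φ` outside `(0,1)` are irrelevant. -/
structure IsDimensionFunction (Φ : ℝ → ℝ) : Prop where
  nonneg : ∀ t ∈ Ioo (0 : ℝ) 1, 0 ≤ Φ t
  mono : MonotoneOn (fun t : ℝ => t ^ (1 + Φ t)) (Ioo 0 1)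
  tendsto : Tendsto (fun t : ℝ => t ^ (1 + Φ t)) (𝓝[>] 0) (𝓝 0)
  doubling : ∃ T : ℝ, 0 < T ∧ T ≤ 1 / 2 ∧ ∃ C : ℝ, 0 < C ∧
    ∀ t : ℝ, 0 < t → t < T → (2 * t) ^ (1 + Φ (2 * t)) ≤ C * t ^ (1 + Φ t)

/-- `Φ` is large: `Φ t = H t * log |log t| / |log t|` near `0`, where `H t → ∞` as `t → 0`. -/
def IsLarge (Φ : ℝ → ℝ) : Prop :=
  ∃ H : ℝ → ℝ, Tendsto H (𝓝[>] 0) atTop ∧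
    ∀ᶠ t in 𝓝[>] (0 : ℝ), Φ t = H t * (Real.log |Real.log t| / |Real.log t|)

section PhiDimension

variable {X : Type*} [PseudoMetricSpace X] [MeasurableSpace X]

/-- The upper `Φ`-dimension of `μ` (equal to `⊤` when no exponent `d` is admissible). -/
def upperPhiDim (Φ : ℝ → ℝ) (μ : Measure X) : EReal :=
  sInf ((fun d : ℝ => (d : EReal)) '' {d : ℝ | ∃ C₁ : ℝ, 0 < C₁ ∧ C₁ < 1 ∧ ∃ C₂ : ℝ, 0 < C₂ ∧
    ∀ r R : ℝ, 0 < r → r < R ^ (1 + Φ R) → R ^ (1 + Φ R) ≤ R → 0 < R → R ≤ C₁ →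
      ∀ x ∈ μ.support,
        μ.real (Metric.ball x R) / μ.real (Metric.ball x r) ≤ C₂ * (R / r) ^ d})

/-- The lower `Φ`-dimension of `μ`. -/
def lowerPhiDim (Φ : ℝ → ℝ) (μ : Measure X) : EReal :=
  sSup ((fun d : ℝ => (d : EReal)) '' {d : ℝ | ∃ C₁ : ℝ, 0 < C₁ ∧ C₁ < 1 ∧ ∃ C₂ : ℝ, 0 < C₂ ∧
    ∀ r R : ℝ, 0 < r → r < R ^ (1 + Φ R) → R ^ (1 + Φ R) ≤ R → 0 < R → R ≤ C₁ →
      ∀ x ∈ μ.support,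
        C₂ * (R / r) ^ d ≤ μ.real (Metric.ball x R) / μ.real (Metric.ball x r)})

end PhiDimension

/-! ### The family of iterated function systems -/

/-- A family, indexed by `u : U`, of iterated function systems of `K` similarities of `[0,1]`,
with scaling ratios `a i u`, uniform bounds `A`, `B` on the ratios, and uniform separation `τ`.
The ratios are random variables on the index space. -/
structure IFSFamily (U : Type*) [MeasurableSpace U] (K : ℕ) where
  S : Fin K → U → I → I
  a : Fin K → U → ℝ
  A : ℝ
  B : ℝ
  τ : ℝ
  two_le : 2 ≤ K
  A_pos : 0 < A
  K_mul_A_le : K * A ≤ B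
  B_lt_one : B < 1
  τ_pos : 0 < τ
  τ_le : τ ≤ (1 - B) / K
  similarity : ∀ i u x y, dist (S i u x) (S i u y) = a i u * dist x y
  A_le : ∀ i u, A ≤ a i u
  sum_le : ∀ u, ∑ i, a i u ≤ B
  separated : ∀ i j, i ≠ j → ∀ u x y, τ ≤ dist (S i u x) (S j u y)
  measurable_a : ∀ i, Measurable (a i)

/-- The space of all probability weight vectors, with its Borel structure. -/
abbrev Weights (K : ℕ) : Type := stdSimplex ℝ (Fin K)

/-- The probability measure on `{1, …, K}` with weights `p`. -/
def weightMeasure {K : ℕ} (p : Weights K) : Measure (Fin K) :=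
  ∑ i, ENNReal.ofReal (p.1 i) • Measure.dirac i

theorem weightMeasure_singleton {K : ℕ} (p : Weights K) (i : Fin K) :
    weightMeasure p {i} = ENNReal.ofReal (p.1 i) := by
  simp [weightMeasure, Set.indicator_apply]

instance {K : ℕ} (p : Weights K) : IsProbabilityMeasure (weightMeasure p) := by
  refine ⟨?_⟩
  simp only [weightMeasure, Measure.coe_finsetSum, Finset.sum_apply, Measure.smul_apply,
    measure_univ, smul_eq_mul, mul_one]
  rw [← ENNReal.ofReal_sum_of_nonneg (fun i _ => p.2.1 i), p.2.2, ENNReal.ofReal_one]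

namespace IFSFamily

variable {U : Type*} [MeasurableSpace U] {K : ℕ} (M : IFSFamily U K)

/-- The composition `S_{ω 0}(u 0) ∘ ⋯ ∘ S_{ω (n-1)}(u (n-1))`. -/
def comp (u : ℕ → U) (ω : ℕ → Fin K) : ℕ → I → I
  | 0 => id
  | n + 1 => comp u ω n ∘ M.S (ω n) (u n)

/-- The Moran interval of level `n` with address `ω 0, …, ω (n-1)`. -/
def moranInterval (u : ℕ → U) (ω : ℕ → Fin K) (n : ℕ) : Set I :=
  range (M.comp u ω n)

/-- The point lying in all the Moran intervals along the infinite address `ω`. -/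
def code (u : ℕ → U) (ω : ℕ → Fin K) : I :=
  limUnder atTop (fun n => M.comp u ω n 0)

/-- The Moran measure `μ_λ` of a sequence `λ` of pairs (system, weight vector): the image of the
product of the weights under the coding map. It is the Borel probability measure with
`μ_λ(I_{i_1, …, i_n}) = p(i_1, λ_1) ⋯ p(i_n, λ_n)`; see `moranMeasure_moranInterval`. -/
def moranMeasure (l : ℕ → U × Weights K) : Measure I :=
  (Measure.infinitePi (fun n => weightMeasure (l n).2)).map (M.code (fun n => (l n).1))

section basic

variable {M}

theorem B_pos : 0 < M.B := by
  have h1 := M.K_mul_A_le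
  have h2 : (0 : ℝ) < K := by exact_mod_cast (by have := M.two_le; omega : 0 < K)
  have := mul_pos h2 M.A_pos
  linarith

theorem a_le_B (i : Fin K) (u : U) : M.a i u ≤ M.B :=
  (Finset.single_le_sum (f := fun i => M.a i u)
    (fun j _ => M.A_pos.le.trans (M.A_le j u)) (Finset.mem_univ i)).trans (M.sum_le u)

theorem S_injective (i : Fin K) (u : U) : Function.Injective (M.S i u) := by
  intro x y h
  have h1 := M.similarity i u x y
  rw [h, dist_self] at h1
  have h2 : 0 < M.a i u := M.A_pos.trans_le (M.A_le i u)
  exact dist_eq_zero.1 ((mul_eq_zero.1 h1.symm).resolve_left h2.ne')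

theorem comp_injective (u : ℕ → U) (ω : ℕ → Fin K) (n : ℕ) :
    Function.Injective (M.comp u ω n) := by
  induction n with
  | zero => exact Function.injective_id
  | succ n ih => exact ih.comp (S_injective _ _)

theorem dist_comp_le (u : ℕ → U) (ω : ℕ → Fin K) (n : ℕ) (x y : I) :
    dist (M.comp u ω n x) (M.comp u ω n y) ≤ M.B ^ n * dist x y := by
  induction n generalizing x y with
  | zero => simp [comp]
  | succ n ih =>
    refine (ih _ _).trans ?_
    rw [M.similarity, pow_succ, mul_assoc]
    have := B_pos (M := M)
    have := a_le_B (M := M) (ω n) (u n)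
    gcongr

theorem comp_mem (u : ℕ → U) (ω : ℕ → Fin K) (n k : ℕ) (x : I) :
    M.comp u ω (n + k) x ∈ M.moranInterval u ω n := by
  induction k generalizing x with
  | zero => exact ⟨x, rfl⟩
  | succ k ih => exact ih _

theorem tendsto_code (u : ℕ → U) (ω : ℕ → Fin K) :
    Tendsto (fun n => M.comp u ω n 0) atTop (𝓝 (M.code u ω)) := by
  have hc : CauchySeq (fun n => M.comp u ω n (0 : I)) := by
    refine cauchySeq_of_le_geometric M.B 1 M.B_lt_one fun n => ?_
    refine (dist_comp_le u ω n 0 (M.S (ω n) (u n) 0)).trans ?_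
    have h : dist (0 : I) (M.S (ω n) (u n) 0) ≤ 1 := by
      rw [Subtype.dist_eq, Real.dist_eq, abs_le]
      have h0 := (M.S (ω n) (u n) 0).2
      constructor <;> simp <;> linarith [h0.1, h0.2]
    have := B_pos (M := M)
    rw [one_mul]
    exact mul_le_of_le_one_right (by positivity) h
  exact CauchySeq.tendsto_limUnder hc

theorem comp_continuous (u : ℕ → U) (ω : ℕ → Fin K) (n : ℕ) :
    Continuous (M.comp u ω n) := by
  refine (LipschitzWith.of_dist_le_mul (K := ⟨M.B ^ n, pow_nonneg B_pos.le n⟩)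
    fun x y => ?_).continuous
  exact dist_comp_le u ω n x y

theorem isClosed_moranInterval (u : ℕ → U) (ω : ℕ → Fin K) (n : ℕ) :
    IsClosed (M.moranInterval u ω n) :=
  (isCompact_range (comp_continuous u ω n)).isClosed

theorem code_mem (u : ℕ → U) (ω : ℕ → Fin K) (n : ℕ) :
    M.code u ω ∈ M.moranInterval u ω n := by
  refine (isClosed_moranInterval u ω n).mem_of_tendsto (tendsto_code u ω) ?_
  filter_upwards [eventually_ge_atTop n] with m hm
  obtain ⟨k, rfl⟩ := Nat.exists_eq_add_of_le hm
  exact comp_mem u ω n k 0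

theorem comp_congr (u : ℕ → U) {ω ω' : ℕ → Fin K} {n : ℕ} (h : ∀ k < n, ω k = ω' k) :
    M.comp u ω n = M.comp u ω' n := by
  induction n with
  | zero => rfl
  | succ n ih =>
    simp only [comp]
    rw [ih fun k hk => h k (by omega), h n (by omega)]

theorem address_eq (u : ℕ → U) {ω ω' : ℕ → Fin K} {n : ℕ} {x : I}
    (h : x ∈ M.moranInterval u ω n) (h' : x ∈ M.moranInterval u ω' n) :
    ∀ k < n, ω k = ω' k := by
  induction n with
  | zero => intro k hk; omega
  | succ n ih =>
    obtain ⟨y, rfl⟩ := h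
    obtain ⟨z, hz⟩ := h'
    have hn := ih ⟨_, rfl⟩ ⟨_, hz⟩
    intro k hk
    rcases Nat.lt_succ_iff_lt_or_eq.1 hk with hk | rfl
    · exact hn k hk
    · by_contra hne
      have h1 : M.comp u ω' k (M.S (ω' k) (u k) z) = M.comp u ω' k (M.S (ω k) (u k) y) := by
        rw [← comp_congr u hn]
        rw [← comp_congr (M := M) u (n := k + 1) (ω := ω') (ω' := ω') fun _ _ => rfl] at hz
        simpa [comp, comp_congr (M := M) u hn] using hz
      have h2 := comp_injective u ω' k h1
      have h3 := M.separated (ω k) (ω' k) hne (u k) y z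
      rw [h2, dist_self] at h3
      exact absurd M.τ_pos (not_lt.2 h3)

theorem code_preimage (u : ℕ → U) (ω : ℕ → Fin K) (n : ℕ) :
    M.code u ⁻¹' M.moranInterval u ω n =
      Set.pi (Finset.range n : Set ℕ) (fun k => {ω k}) := by
  ext η
  simp only [mem_preimage, Set.mem_pi, Finset.coe_range, mem_Iio, mem_singleton_iff]
  constructor
  · intro h
    exact address_eq u (code_mem u η n) h
  · intro h
    have := code_mem (M := M) u η n
    rwa [moranInterval, comp_congr u h] at this

theorem measurable_code (u : ℕ → U) : Measurable (M.code u) := by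
  refine measurable_of_tendsto_metrizable (f := fun n ω => M.comp u ω n 0) (fun n => ?_)
    (tendsto_pi_nhds.2 fun ω => tendsto_code u ω)
  suffices h : ∀ x : I, Measurable fun ω : ℕ → Fin K => M.comp u ω n x from h 0
  induction n with
  | zero => intro x; exact measurable_const
  | succ n ih =>
    intro x
    have h1 : Measurable fun q : Fin K × (ℕ → Fin K) => M.comp u q.2 n (M.S q.1 (u n) x) :=
      measurable_from_prod_countable_right fun i => ih (M.S i (u n) x)
    have h2 : Measurable fun ω : ℕ → Fin K => (ω n, ω) :=
      (measurable_pi_apply n).prodMk measurable_id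
    exact h1.comp h2

end basic

instance (l : ℕ → U × Weights K) : IsProbabilityMeasure (M.moranMeasure l) :=
  Measure.isProbabilityMeasure_map (measurable_code _).aemeasurable

/-- The defining rule of the Moran measure. -/
theorem moranMeasure_moranInterval (l : ℕ → U × Weights K) (ω : ℕ → Fin K) (n : ℕ) :
    M.moranMeasure l (M.moranInterval (fun k => (l k).1) ω n) =
      ∏ k ∈ Finset.range n, ENNReal.ofReal ((l k).2.1 (ω k)) := by
  rw [moranMeasure, Measure.map_apply (measurable_code _)
    (isClosed_moranInterval _ _ _).measurableSet, code_preimage, Measure.infinitePi_pi]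
  · exact Finset.prod_congr rfl fun k _ => weightMeasure_singleton _ _
  · exact fun k _ => measurableSet_singleton _

/-! ### Almost sure dimensions in the independent case -/

/-- `s` is the almost sure value of the upper `Φ`-dimension of the random measure `μ_𝓡`, when
systems and weights are drawn independently with laws `Q` and `𝓡`, i.i.d. over the steps. -/
def IsUpperDim (Q : Measure U) [IsProbabilityMeasure Q] (Φ : ℝ → ℝ)
    (R : ProbabilityMeasure (Weights K)) (s : EReal) : Prop :=
  ∀ᵐ l ∂(Measure.infinitePi fun _ : ℕ => Q.prod (R : Measure (Weights K))),
    upperPhiDim Φ (M.moranMeasure l) = s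

/-- `s` is the almost sure value of the lower `Φ`-dimension of the random measure `μ_𝓡`. -/
def IsLowerDim (Q : Measure U) [IsProbabilityMeasure Q] (Φ : ℝ → ℝ)
    (R : ProbabilityMeasure (Weights K)) (s : EReal) : Prop :=
  ∀ᵐ l ∂(Measure.infinitePi fun _ : ℕ => Q.prod (R : Measure (Weights K))),
    lowerPhiDim Φ (M.moranMeasure l) = s

end IFSFamily

/-- The standing integrability condition on the law of the weights: for some `t > 0`,
`E (p i ^ (-t)) < ∞` for every `i` (with `0 ^ (-t) = ∞`). -/
def Admissible {K : ℕ} (R : ProbabilityMeasure (Weights K)) : Prop :=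
  ∃ t : ℝ, 0 < t ∧ ∀ i : Fin K,
    ∫⁻ p : Weights K, ENNReal.ofReal (p.1 i) ^ (-t) ∂(R : Measure (Weights K)) < ∞

/-- A single weight vector is valid if all its components are nonzero. -/
def IsValid {K : ℕ} (p : Weights K) : Prop := ∀ i, p.1 i ≠ 0

/-- The law of a deterministic weight vector. -/
def single {K : ℕ} (p : Weights K) : ProbabilityMeasure (Weights K) :=
  ⟨Measure.dirac p, inferInstance⟩

namespace IFSFamily

variable {U : Type*} [MeasurableSpace U] {K : ℕ} (M : IFSFamily U K)

/-- The attainable almost sure upper `Φ`-dimensions with independent weights. -/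
def upperDims (Q : Measure U) [IsProbabilityMeasure Q] (Φ : ℝ → ℝ) : Set EReal :=
  {s | ∃ R : ProbabilityMeasure (Weights K), Admissible R ∧ M.IsUpperDim Q Φ R s}

/-- The attainable almost sure lower `Φ`-dimensions with independent weights. -/
def lowerDims (Q : Measure U) [IsProbabilityMeasure Q] (Φ : ℝ → ℝ) : Set EReal :=
  {s | ∃ R : ProbabilityMeasure (Weights K), Admissible R ∧ M.IsLowerDim Q Φ R s}

end IFSFamily

end RandomMoran

end

/-!
The score of the branch `i` for a system `u` and weights `p`, at exponent `d`, is
`d * log (a i u) - log (p i)`. The ratio of the masses of two nested Moran intervals equals the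
`d`-th power of the ratio of their lengths times the exponential of the sum of the scores along the
levels between them (`mass_div_mass`), and by the uniform separation the measures of balls are
comparable to the masses of Moran intervals. So `d` is admissible for the upper dimension when the
sums of the largest scores over all relevant windows of levels are bounded above, and for the lower
dimension when the sums of the smallest scores are bounded below.

For large `Φ` the relevant windows `[n, m)` have length at least any prescribed multiple of `log n`
(`IsLarge.rpow_le`). A Chernoff bound and the Borel-Cantelli lemma show that the sums over such
windows eventually have the sign of the mean (`exists_ae_window_sum_le`). The exponential moment
needed is provided by the condition `E (p i ^ (-t)) < ∞`. Hence the almost sure upper (lower)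
dimension is the unique zero in `d` of the mean of the largest (smallest) score, a strictly
decreasing function of `d` (`isUpperDim_of_integral_eq_zero`, `isLowerDim_of_integral_eq_zero`).

Systems and weights being independent, the mean score under `R` is the average over `p` of the mean
scores under single weight vectors `p`. If the former has a given sign, so has the latter for some
`p`; thus single weight vectors do as well as random ones. A compactness argument shows that `d`
and `d'` themselves are reached (`exists_maxScore_nonpos`, `exists_minScore_nonneg`), and the
intermediate value theorem on a segment towards a vertex of the simplex gives all other values.
-/

namespace RandomMoran

section Mass

variable {U : Type*} {K : ℕ}

/-- The mass of the Moran interval of level `n` with address `ω`. -/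
def mass (l : ℕ → U × Weights K) (ω : ℕ → Fin K) (n : ℕ) : ℝ :=
  ∏ k ∈ Finset.range n, (l k).2.1 (ω k)

theorem mass_pos {l : ℕ → U × Weights K} (hl : ∀ k i, 0 < (l k).2.1 i) (ω : ℕ → Fin K) (n : ℕ) :
    0 < mass l ω n :=
  Finset.prod_pos fun _ _ => hl _ _

end Mass

namespace IFSFamily

variable {U : Type*} [MeasurableSpace U] {K : ℕ} {M : IFSFamily U K}

/-! ### Geometry of the Moran intervals -/

variable (M) in
/-- The length of the Moran interval of level `n` with address `ω`. -/
def len (u : ℕ → U) (ω : ℕ → Fin K) (n : ℕ) : ℝ :=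
  ∏ k ∈ Finset.range n, M.a (ω k) (u k)

theorem a_pos (i : Fin K) (u : U) : 0 < M.a i u := M.A_pos.trans_le (M.A_le i u)

theorem A_lt_one : M.A < 1 := by
  have h1 := M.K_mul_A_le
  have h2 : (2 : ℝ) ≤ K := by exact_mod_cast M.two_le
  nlinarith [M.A_pos, M.B_lt_one]

theorem τ_lt_one : M.τ < 1 := by
  have h2 : (2 : ℝ) ≤ K := by exact_mod_cast M.two_le
  have h3 := M.τ_le
  rw [le_div_iff₀ (by linarith)] at h3
  nlinarith [M.τ_pos, B_pos (M := M)]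

theorem len_pos (u : ℕ → U) (ω : ℕ → Fin K) (n : ℕ) : 0 < M.len u ω n :=
  Finset.prod_pos fun _ _ => a_pos _ _

theorem len_succ (u : ℕ → U) (ω : ℕ → Fin K) (n : ℕ) :
    M.len u ω (n + 1) = M.len u ω n * M.a (ω n) (u n) :=
  Finset.prod_range_succ _ _

theorem A_mul_len_le (u : ℕ → U) (ω : ℕ → Fin K) (n : ℕ) :
    M.A * M.len u ω n ≤ M.len u ω (n + 1) := by
  rw [len_succ, mul_comm]
  exact mul_le_mul_of_nonneg_left (M.A_le _ _) (len_pos _ _ _).le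

theorem len_antitone (u : ℕ → U) (ω : ℕ → Fin K) : Antitone (M.len u ω) := by
  refine antitone_nat_of_succ_le fun n => ?_
  rw [len_succ]
  exact mul_le_of_le_one_right (len_pos _ _ _).le ((a_le_B _ _).trans M.B_lt_one.le)

theorem A_pow_mul_len_le (u : ℕ → U) (ω : ℕ → Fin K) (n j : ℕ) :
    M.A ^ j * M.len u ω n ≤ M.len u ω (n + j) := by
  induction j with
  | zero => simp
  | succ j ih =>
    rw [pow_succ', mul_assoc]
    exact (mul_le_mul_of_nonneg_left ih M.A_pos.le).trans (A_mul_len_le u ω (n + j))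

theorem A_pow_le_len (u : ℕ → U) (ω : ℕ → Fin K) (n : ℕ) : M.A ^ n ≤ M.len u ω n := by
  simpa [len] using A_pow_mul_len_le (M := M) u ω 0 n

theorem len_le_B_pow (u : ℕ → U) (ω : ℕ → Fin K) (n : ℕ) : M.len u ω n ≤ M.B ^ n := by
  induction n with
  | zero => simp [len]
  | succ n ih =>
    rw [len_succ, pow_succ]
    exact mul_le_mul ih (a_le_B _ _) (a_pos _ _).le (pow_nonneg B_pos.le _)

theorem len_tendsto (u : ℕ → U) (ω : ℕ → Fin K) : Tendsto (M.len u ω) atTop (𝓝 0) :=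
  squeeze_zero (fun n => (len_pos u ω n).le) (len_le_B_pow u ω)
    (tendsto_pow_atTop_nhds_zero_of_lt_one B_pos.le M.B_lt_one)

/-- Every scale in `(0, 1]` lies between two consecutive lengths along a given address. -/
theorem exists_len_scale (u : ℕ → U) (ω : ℕ → Fin K) {ρ : ℝ} (h0 : 0 < ρ) (h1 : ρ ≤ 1) :
    ∃ n, M.len u ω (n + 1) < ρ ∧ ρ ≤ M.len u ω n := by
  classical
  have hex : ∃ n, M.len u ω n < ρ := ((len_tendsto u ω).eventually (gt_mem_nhds h0)).exists
  have hne : Nat.find hex ≠ 0 := by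
    intro h
    have := Nat.find_spec hex
    rw [h] at this
    simp only [len, Finset.range_zero, Finset.prod_empty] at this
    linarith
  obtain ⟨n, hn⟩ := Nat.exists_eq_succ_of_ne_zero hne
  refine ⟨n, ?_, ?_⟩
  · have := Nat.find_spec hex
    rwa [hn] at this
  · exact not_lt.1 (Nat.find_min hex (by omega))

theorem dist_comp (u : ℕ → U) (ω : ℕ → Fin K) (n : ℕ) (x y : I) :
    dist (M.comp u ω n x) (M.comp u ω n y) = M.len u ω n * dist x y := by
  induction n generalizing x y with
  | zero => simp [comp, len]
  | succ n ih =>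
    rw [len_succ, mul_assoc, ← M.similarity]
    exact ih _ _

theorem dist_le_len (u : ℕ → U) (ω : ℕ → Fin K) (n : ℕ) {x y : I}
    (hx : x ∈ M.moranInterval u ω n) (hy : y ∈ M.moranInterval u ω n) :
    dist x y ≤ M.len u ω n := by
  obtain ⟨x, rfl⟩ := hx
  obtain ⟨y, rfl⟩ := hy
  rw [dist_comp]
  refine mul_le_of_le_one_right (len_pos _ _ _).le ?_
  rw [Subtype.dist_eq, Real.dist_eq, abs_le]
  constructor <;> linarith [x.2.1, x.2.2, y.2.1, y.2.2]

theorem moranInterval_congr (u : ℕ → U) {ω ω' : ℕ → Fin K} {n : ℕ} (h : ∀ k < n, ω k = ω' k) :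
    M.moranInterval u ω n = M.moranInterval u ω' n := by
  rw [moranInterval, moranInterval, comp_congr u h]

theorem moranInterval_anti (u : ℕ → U) (ω : ℕ → Fin K) {n m : ℕ} (h : n ≤ m) :
    M.moranInterval u ω m ⊆ M.moranInterval u ω n := by
  obtain ⟨k, rfl⟩ := Nat.exists_eq_add_of_le h
  rintro _ ⟨x, rfl⟩
  exact comp_mem u ω n k x

/-- Points in different Moran intervals of level `n` are at least `τ` times the length of either
interval apart. -/
theorem eq_of_dist_lt (u : ℕ → U) {ω ω' : ℕ → Fin K} {n : ℕ} {x y : I}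
    (hx : x ∈ M.moranInterval u ω n) (hy : y ∈ M.moranInterval u ω' n)
    (h : dist x y < M.τ * M.len u ω n) : ∀ k < n, ω k = ω' k := by
  intro k
  induction k using Nat.strong_induction_on with
  | _ k ih =>
    intro hk
    by_contra hne
    obtain ⟨x', rfl⟩ := moranInterval_anti u ω (show k + 1 ≤ n by omega) hx
    obtain ⟨y', rfl⟩ := moranInterval_anti u ω' (show k + 1 ≤ n by omega) hy
    have hc : M.comp u ω k = M.comp u ω' k := comp_congr u fun j hj => ih j hj (by omega)
    simp only [comp, Function.comp_apply, ← hc] at h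
    rw [dist_comp] at h
    have h1 := M.separated (ω k) (ω' k) hne (u k) x' y'
    have h2 := len_antitone (M := M) u ω (show k ≤ n by omega)
    nlinarith [M.τ_pos, len_pos (M := M) u ω k]

/-! ### The Moran measure of balls -/

theorem moranMeasure_real (l : ℕ → U × Weights K) (ω : ℕ → Fin K) (n : ℕ) :
    (M.moranMeasure l).real (M.moranInterval (fun k => (l k).1) ω n) = mass l ω n := by
  rw [measureReal_def, moranMeasure_moranInterval,
    ← ENNReal.ofReal_prod_of_nonneg fun k _ => (l k).2.2.1 _, ENNReal.toReal_ofReal]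
  · rfl
  · exact Finset.prod_nonneg fun k _ => (l k).2.2.1 _

theorem mass_le_ball (l : ℕ → U × Weights K) {ω : ℕ → Fin K} {n : ℕ} {x : I} {r : ℝ}
    (hx : x ∈ M.moranInterval (fun k => (l k).1) ω n)
    (hr : M.len (fun k => (l k).1) ω n < r) :
    mass l ω n ≤ (M.moranMeasure l).real (Metric.ball x r) := by
  rw [← moranMeasure_real (M := M)]
  refine measureReal_mono fun y hy => ?_
  exact (dist_le_len _ _ _ hy hx).trans_lt hr

theorem ball_le_mass (l : ℕ → U × Weights K) {ω : ℕ → Fin K} {n : ℕ} {x : I} {r : ℝ}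
    (hx : x ∈ M.moranInterval (fun k => (l k).1) ω n)
    (hr : r ≤ M.τ * M.len (fun k => (l k).1) ω n) :
    (M.moranMeasure l).real (Metric.ball x r) ≤ mass l ω n := by
  rw [← moranMeasure_real (M := M), measureReal_def, measureReal_def]
  refine ENNReal.toReal_mono (measure_ne_top _ _) ?_
  rw [moranMeasure, Measure.map_apply (measurable_code _) Metric.isOpen_ball.measurableSet,
    Measure.map_apply (measurable_code _) (isClosed_moranInterval _ _ _).measurableSet]
  refine measure_mono fun η hη => ?_
  have h1 : dist x (M.code (fun k => (l k).1) η) < M.τ * M.len (fun k => (l k).1) ω n := by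
    rw [dist_comm]
    exact (Metric.mem_ball.1 hη).trans_le hr
  have h2 := eq_of_dist_lt _ hx (code_mem _ η n) h1
  rw [mem_preimage, moranInterval_congr _ h2]
  exact code_mem _ η n

/-- Every point of the support of the Moran measure has an infinite address. -/
theorem exists_address {l : ℕ → U × Weights K} {x : I} (hx : x ∈ (M.moranMeasure l).support) :
    ∃ ω : ℕ → Fin K, ∀ n, x ∈ M.moranInterval (fun k => (l k).1) ω n := by
  set u : ℕ → U := fun k => (l k).1 with hu
  have hlev : ∀ n, ∃ ω : ℕ → Fin K, x ∈ M.moranInterval u ω n := by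
    intro n
    have hfin : (range fun ω : ℕ → Fin K => M.moranInterval u ω n).Finite := by
      have i0 : Fin K := ⟨0, by have := M.two_le; omega⟩
      refine (Set.finite_range fun v : Fin n → Fin K => M.moranInterval u
        (fun k => if h : k < n then v ⟨k, h⟩ else i0) n).subset ?_
      rintro _ ⟨ω, rfl⟩
      refine ⟨fun k => ω k, moranInterval_congr u fun k hk => ?_⟩
      simp [hk]
    have hcl : IsClosed (⋃₀ range fun ω : ℕ → Fin K => M.moranInterval u ω n) := by
      rw [sUnion_eq_biUnion]
      refine hfin.isClosed_biUnion ?_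
      rintro _ ⟨ω, rfl⟩
      exact isClosed_moranInterval u ω n
    have hae : (⋃₀ range fun ω : ℕ → Fin K => M.moranInterval u ω n) ∈ ae (M.moranMeasure l) := by
      rw [moranMeasure, mem_ae_map_iff (measurable_code _).aemeasurable hcl.measurableSet]
      refine Filter.mem_of_superset univ_mem fun η _ => ?_
      exact ⟨_, ⟨η, rfl⟩, code_mem u η n⟩
    obtain ⟨_, ⟨ω, rfl⟩, h⟩ := Measure.support_subset_of_isClosed hcl hae hx
    exact ⟨ω, h⟩
  choose ω hω using hlev
  -- the addresses of the different levels agree where both apply, by disjointness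
  refine ⟨fun k => ω (k + 1) k, fun n => ?_⟩
  have := hω n
  rwa [moranInterval_congr u (ω' := ω n)]
  intro k hk
  exact address_eq u (hω (k + 1)) (moranInterval_anti u (ω n) (by omega) (hω n)) k (by omega)

theorem ball_pos {l : ℕ → U × Weights K} (hl : ∀ k i, 0 < (l k).2.1 i) {ω : ℕ → Fin K} {x : I}
    (hx : ∀ n, x ∈ M.moranInterval (fun k => (l k).1) ω n) {r : ℝ} (hr : 0 < r) :
    0 < (M.moranMeasure l).real (Metric.ball x r) := by
  obtain ⟨n, hn⟩ := ((len_tendsto (M := M) (fun k => (l k).1) ω).eventually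
    (gt_mem_nhds hr)).exists
  exact (mass_pos hl ω n).trans_le (mass_le_ball l (hx n) hn)

theorem code_mem_support {l : ℕ → U × Weights K} (hl : ∀ k i, 0 < (l k).2.1 i)
    (ω : ℕ → Fin K) : M.code (fun k => (l k).1) ω ∈ (M.moranMeasure l).support := by
  rw [Measure.mem_support_iff_forall]
  intro V hV
  obtain ⟨r, hr, hrV⟩ := Metric.mem_nhds_iff.1 hV
  have h := ball_pos (M := M) hl (code_mem (fun k => (l k).1) ω) hr
  rw [measureReal_def, ENNReal.toReal_pos_iff] at h
  exact h.1.trans_le (measure_mono hrV)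

/-! ### Scores and the local dimension between two levels -/

variable (M) in
/-- The score of the branch `i` for the pair `z` of a system and a weight vector, relative to the
exponent `d`: the logarithm of `a i ^ d / p i`. -/
noncomputable def score (d : ℝ) (z : U × Weights K) (i : Fin K) : ℝ :=
  d * Real.log (M.a i z.1) - Real.log (z.2.1 i)

/-- The masses of nested Moran intervals compare as the `d`-th powers of their lengths, up to the
exponential of the sum of the scores in between. -/
theorem mass_div_mass {l : ℕ → U × Weights K} (hl : ∀ k i, 0 < (l k).2.1 i) (d : ℝ)
    (ω : ℕ → Fin K) {n m : ℕ} (h : n ≤ m) :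
    mass l ω n / mass l ω m =
      Real.exp (∑ k ∈ Finset.Ico n m, M.score d (l k) (ω k)) *
        (M.len (fun k => (l k).1) ω n / M.len (fun k => (l k).1) ω m) ^ d := by
  have h1 : mass l ω m = mass l ω n * ∏ k ∈ Finset.Ico n m, (l k).2.1 (ω k) :=
    (Finset.prod_range_mul_prod_Ico _ h).symm
  have h2 : M.len (fun k => (l k).1) ω m =
      M.len (fun k => (l k).1) ω n * ∏ k ∈ Finset.Ico n m, M.a (ω k) (l k).1 :=
    (Finset.prod_range_mul_prod_Ico _ h).symm
  have h3 : Real.exp (∑ k ∈ Finset.Ico n m, M.score d (l k) (ω k)) =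
      (∏ k ∈ Finset.Ico n m, M.a (ω k) (l k).1) ^ d / ∏ k ∈ Finset.Ico n m, (l k).2.1 (ω k) := by
    rw [Real.exp_sum, ← Real.finsetProd_rpow _ _ fun k _ => (a_pos _ _).le,
      ← Finset.prod_div_distrib]
    refine Finset.prod_congr rfl fun k _ => ?_
    rw [score, Real.exp_sub, Real.exp_log (hl _ _), Real.rpow_def_of_pos (a_pos _ _), mul_comm d]
  have ha : 0 < ∏ k ∈ Finset.Ico n m, M.a (ω k) (l k).1 := Finset.prod_pos fun _ _ => a_pos _ _
  have hp : 0 < ∏ k ∈ Finset.Ico n m, (l k).2.1 (ω k) := Finset.prod_pos fun _ _ => hl _ _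
  have hm := mass_pos hl ω n
  have hn := len_pos (M := M) (fun k => (l k).1) ω n
  rw [h1, h2, h3, ← div_div, ← div_div, div_self hm.ne', div_self hn.ne', one_div, one_div,
    Real.inv_rpow ha.le]
  have := (Real.rpow_pos_of_pos ha d).ne'
  field_simp

end IFSFamily

end RandomMoran

namespace RandomMoran

/-! ### The exponents admissible in the definitions of the `Φ`-dimensions -/

section Exponents

variable {X : Type*} [PseudoMetricSpace X] [MeasurableSpace X]

/-- The exponents over which the infimum in the definition of the upper `Φ`-dimension is taken. -/
def upperExponents (Φ : ℝ → ℝ) (μ : Measure X) : Set ℝ :=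
  {d : ℝ | ∃ C₁ : ℝ, 0 < C₁ ∧ C₁ < 1 ∧ ∃ C₂ : ℝ, 0 < C₂ ∧
    ∀ r R : ℝ, 0 < r → r < R ^ (1 + Φ R) → R ^ (1 + Φ R) ≤ R → 0 < R → R ≤ C₁ →
      ∀ x ∈ μ.support,
        μ.real (Metric.ball x R) / μ.real (Metric.ball x r) ≤ C₂ * (R / r) ^ d}

/-- The exponents over which the supremum in the definition of the lower `Φ`-dimension is taken. -/
def lowerExponents (Φ : ℝ → ℝ) (μ : Measure X) : Set ℝ :=
  {d : ℝ | ∃ C₁ : ℝ, 0 < C₁ ∧ C₁ < 1 ∧ ∃ C₂ : ℝ, 0 < C₂ ∧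
    ∀ r R : ℝ, 0 < r → r < R ^ (1 + Φ R) → R ^ (1 + Φ R) ≤ R → 0 < R → R ≤ C₁ →
      ∀ x ∈ μ.support,
        C₂ * (R / r) ^ d ≤ μ.real (Metric.ball x R) / μ.real (Metric.ball x r)}

theorem upperExponents_mono {Φ : ℝ → ℝ} {μ : Measure X} {d e : ℝ} (hd : d ∈ upperExponents Φ μ)
    (h : d ≤ e) : e ∈ upperExponents Φ μ := by
  obtain ⟨C₁, h1, h2, C₂, h3, H⟩ := hd
  refine ⟨C₁, h1, h2, C₂, h3, fun r R hr hrR hR hR0 hRC x hx => ?_⟩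
  refine (H r R hr hrR hR hR0 hRC x hx).trans ?_
  have : 1 ≤ R / r := (one_le_div hr).2 (hrR.le.trans hR)
  gcongr

theorem lowerExponents_anti {Φ : ℝ → ℝ} {μ : Measure X} {d e : ℝ} (hd : d ∈ lowerExponents Φ μ)
    (h : e ≤ d) : e ∈ lowerExponents Φ μ := by
  obtain ⟨C₁, h1, h2, C₂, h3, H⟩ := hd
  refine ⟨C₁, h1, h2, C₂, h3, fun r R hr hrR hR hR0 hRC x hx => ?_⟩
  refine le_trans ?_ (H r R hr hrR hR hR0 hRC x hx)
  have : 1 ≤ R / r := (one_le_div hr).2 (hrR.le.trans hR)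
  gcongr

theorem upperPhiDim_eq {Φ : ℝ → ℝ} {μ : Measure X} {s : ℝ} {a b : ℕ → ℝ}
    (ha : Tendsto a atTop (𝓝 s)) (hb : Tendsto b atTop (𝓝 s))
    (ha' : ∀ n, a n ∈ upperExponents Φ μ) (hb' : ∀ n, b n ∉ upperExponents Φ μ) :
    upperPhiDim Φ μ = s := by
  refine le_antisymm ?_ ?_
  · refine ge_of_tendsto' ((continuous_coe_real_ereal.tendsto s).comp ha) fun n => ?_
    exact sInf_le ⟨a n, ha' n, rfl⟩
  · refine le_sInf ?_
    rintro _ ⟨d, hd, rfl⟩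
    refine EReal.coe_le_coe_iff.2 (le_of_tendsto' hb fun n => ?_)
    by_contra! hlt
    exact hb' n (upperExponents_mono hd hlt.le)

theorem lowerPhiDim_eq {Φ : ℝ → ℝ} {μ : Measure X} {s : ℝ} {a b : ℕ → ℝ}
    (ha : Tendsto a atTop (𝓝 s)) (hb : Tendsto b atTop (𝓝 s))
    (ha' : ∀ n, a n ∈ lowerExponents Φ μ) (hb' : ∀ n, b n ∉ lowerExponents Φ μ) :
    lowerPhiDim Φ μ = s := by
  refine le_antisymm ?_ ?_
  · refine sSup_le ?_
    rintro _ ⟨d, hd, rfl⟩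
    refine EReal.coe_le_coe_iff.2 (ge_of_tendsto' hb fun n => ?_)
    by_contra! hlt
    exact hb' n (lowerExponents_anti hd hlt.le)
  · refine le_of_tendsto' ((continuous_coe_real_ereal.tendsto s).comp ha) fun n => ?_
    exact le_sSup ⟨a n, ha' n, rfl⟩

end Exponents

/-- The number of levels that is negligible at level `n`: `L * log (n + 1)`, rounded up. -/
noncomputable def gap (L : ℝ) (n : ℕ) : ℕ := ⌈L * Real.log (n + 1)⌉₊

/-- For a large dimension function `Φ` the scales `R` and `R ^ (1 + Φ R)` are separated by more
than any constant times `log n` levels, where `n` is a level whose Moran intervals may have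
length comparable to `R`. -/
theorem IsLarge.rpow_le {Φ : ℝ → ℝ} (hΦ : IsLarge Φ) {A B c L : ℝ} (hA : 0 < A) (hA1 : A < 1)
    (hB : 0 < B) (hB1 : B < 1) (hc : 0 < c) (hL : 0 ≤ L) :
    ∀ᶠ R in 𝓝[>] (0 : ℝ), ∀ n : ℕ, A * R ≤ B ^ n →
      R ^ (1 + Φ R) ≤ c * A ^ gap L n * R := by
  obtain ⟨H, hH, hΦH⟩ := hΦ
  have hα : 0 < -Real.log A := neg_pos.2 (Real.log_neg hA hA1)
  have hb : 0 < -Real.log B := neg_pos.2 (Real.log_neg hB hB1)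
  set α := -Real.log A with hαd
  set b := -Real.log B with hbd
  have hy : Tendsto (fun R : ℝ => -Real.log R) (𝓝[>] 0) atTop :=
    tendsto_neg_atBot_atTop.comp Real.tendsto_log_nhdsGT_zero
  have hlin : ∀ᶠ y : ℝ in atTop, (y + α) / b + 1 ≤ y ^ 2 := by
    filter_upwards [eventually_ge_atTop (max 1 ((1 + α) / b + 1))] with y hy
    have h1 : 1 ≤ y := (le_max_left _ _).trans hy
    have h2 : (1 + α) / b + 1 ≤ y := (le_max_right _ _).trans hy
    have h3 : (y + α) / b ≤ y * ((1 + α) / b) := by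
      rw [← mul_div_assoc]
      gcongr
      nlinarith
    nlinarith
  filter_upwards [hΦH, self_mem_nhdsWithin, hH.eventually_ge_atTop (α * (2 * L + 1) + |Real.log c|),
    hy.eventually hlin, hy.eventually_ge_atTop (Real.exp 1)] with R hR hR0 hHR hRlin hRe n hn
  have hR0 : 0 < R := hR0
  set y := -Real.log R with hyd
  have hy1 : 0 < y := (Real.exp_pos 1).trans_le hRe
  have hly : 1 ≤ Real.log y := by rwa [Real.le_log_iff_exp_le hy1]
  have habs : |Real.log R| = y := by rw [hyd, abs_of_neg]; linarith
  have hpow : R ^ (1 + Φ R) = Real.exp (-(H R * Real.log y)) * R := by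
    rw [Real.rpow_add hR0, Real.rpow_one, mul_comm, Real.rpow_def_of_pos hR0, hR, habs,
      show Real.log R = -y by simp [hyd]]
    congr 2
    field_simp
  have hn1 : (n : ℝ) * b ≤ y + α := by
    have h := Real.log_le_log (by positivity) hn
    rw [Real.log_mul hA.ne' hR0.ne', Real.log_pow] at h
    linarith
  have hn2 : (n : ℝ) + 1 ≤ y ^ 2 := by
    rw [← le_div_iff₀ hb] at hn1
    linarith
  have hn3 : Real.log (n + 1) ≤ 2 * Real.log y := by
    have h := Real.log_le_log (by positivity) hn2
    rwa [Real.log_pow] at h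
  have hj : (gap L n : ℝ) ≤ 2 * L * Real.log y + 1 := by
    have h0 : 0 ≤ L * Real.log (n + 1) := mul_nonneg hL (Real.log_nonneg (by simp))
    have h1 := (Nat.ceil_lt_add_one h0).le
    have h2 := mul_le_mul_of_nonneg_left hn3 hL
    rw [gap]
    linarith
  rw [hpow]
  refine mul_le_mul_of_nonneg_right ?_ hR0.le
  rw [← Real.log_le_log_iff (Real.exp_pos _) (by positivity), Real.log_exp,
    Real.log_mul hc.ne' (by positivity), Real.log_pow]
  have h1 := mul_le_mul_of_nonneg_left hj hα.le
  have h2 := mul_le_mul_of_nonneg_right hHR (zero_le_one.trans hly)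
  have h3 := neg_abs_le (Real.log c)
  have h4 : |Real.log c| ≤ |Real.log c| * Real.log y := le_mul_of_one_le_right (abs_nonneg _) hly
  have h5 : α ≤ α * Real.log y := le_mul_of_one_le_right hα.le hly
  nlinarith

namespace IFSFamily

variable {U : Type*} [MeasurableSpace U] {K : ℕ} {M : IFSFamily U K}

/-- If `n` and `m` are the levels of Moran intervals of lengths comparable to `R` and `r`, the
separation of the intervals gives that the measures of the balls are comparable to the masses of
levels `n` and `m`, and largeness of `Φ` that the window `[n, m)` is longer than `gap L n`. -/
theorem mem_upperExponents {Φ : ℝ → ℝ} (hΦ : IsLarge Φ) {l : ℕ → U × Weights K}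
    (hl : ∀ k i, 0 < (l k).2.1 i) {d L : ℝ} (hd : 0 ≤ d) (hL : 0 ≤ L)
    (h : ∃ n₀, ∀ n ≥ n₀, ∀ m, n + gap L n ≤ m → ∀ ω : ℕ → Fin K,
      ∑ k ∈ Finset.Ico n m, M.score d (l k) (ω k) ≤ 0) :
    d ∈ upperExponents Φ (M.moranMeasure l) := by
  obtain ⟨n₀, h⟩ := h
  have hA := M.A_pos
  have hτ := M.τ_pos
  have hτ1 := τ_lt_one (M := M)
  obtain ⟨δ, hδ, hscale⟩ := mem_nhdsGT_iff_exists_Ioo_subset.1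
    (hΦ.rpow_le hA A_lt_one (B_pos (M := M)) M.B_lt_one one_pos hL)
  have hδ : 0 < δ := hδ
  set u : ℕ → U := fun k => (l k).1 with hu
  have hAn : M.A ^ n₀ ≤ 1 := pow_le_one₀ hA.le A_lt_one.le
  refine ⟨min (δ / 2) (M.τ * M.A ^ n₀), by positivity, ?_, (1 / (M.τ * M.A ^ 2)) ^ d,
    by positivity, ?_⟩
  · refine (min_le_right _ _).trans_lt ?_
    nlinarith
  intro r R hr hrR hRR hR0 hRC x hx
  obtain ⟨ω, hω⟩ := exists_address hx
  have hR1 : R ≤ M.τ * M.A ^ n₀ := hRC.trans (min_le_right _ _)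
  have hR2 : R / M.τ ≤ M.A ^ n₀ := by rw [div_le_iff₀ hτ]; linarith
  have hR3 : R ≤ 1 := by nlinarith
  obtain ⟨n, hn1, hn2⟩ := exists_len_scale (M := M) u ω (div_pos hR0 hτ) (hR2.trans hAn)
  obtain ⟨m, hm1, hm2⟩ := exists_len_scale (M := M) u ω hr ((hrR.le.trans hRR).trans hR3)
  rw [div_le_iff₀ hτ] at hn2
  have hn0 : n₀ ≤ n := by
    by_contra! hlt
    have h1 := len_antitone (M := M) u ω (show n + 1 ≤ n₀ by omega)
    have h2 := A_pow_le_len (M := M) u ω n₀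
    linarith
  have hlenn := len_pos (M := M) u ω n
  have hRn : R ≤ M.len u ω n := hn2.trans (mul_le_of_le_one_right hlenn.le hτ1.le)
  have hgap : n + gap L n ≤ m + 1 := by
    by_contra! hlt
    have h1 := hscale (a := R) ⟨hR0, hRC.trans_lt ((min_le_left _ _).trans_lt (by linarith))⟩ n
      ((mul_le_of_le_one_left hR0.le A_lt_one.le).trans (hRn.trans (len_le_B_pow u ω n)))
    have h2 := A_pow_mul_len_le (M := M) u ω n (gap L n)
    have h3 := len_antitone (M := M) u ω hlt.le
    have h4 : M.A ^ gap L n * R ≤ M.A ^ gap L n * M.len u ω n := by gcongr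
    linarith
  have hlenm := len_pos (M := M) u ω (m + 1)
  calc _ ≤ mass l ω n / mass l ω (m + 1) := by
        refine div_le_div₀ (mass_pos hl ω n).le ?_ (mass_pos hl ω _) ?_
        · exact ball_le_mass l (hω n) (by linarith)
        · exact mass_le_ball l (hω _) hm1
    _ ≤ (M.len u ω n / M.len u ω (m + 1)) ^ d := by
        rw [mass_div_mass (M := M) hl d ω (by omega)]
        refine mul_le_of_le_one_left (by positivity) ?_
        exact Real.exp_le_one_iff.2 (h n hn0 _ hgap ω)
    _ ≤ (1 / (M.τ * M.A ^ 2) * (R / r)) ^ d := by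
        refine Real.rpow_le_rpow (by positivity) ?_ hd
        have h1 := A_mul_len_le (M := M) u ω n
        have h2 := A_mul_len_le (M := M) u ω m
        rw [lt_div_iff₀ hτ] at hn1
        have h3 : M.len u ω n ≤ R / (M.τ * M.A) := by
          rw [le_div_iff₀ (by positivity)]
          nlinarith
        have h4 : M.A * r ≤ M.len u ω (m + 1) := by nlinarith
        calc _ ≤ R / (M.τ * M.A) / (M.A * r) := by gcongr
          _ = _ := by field_simp
    _ = _ := Real.mul_rpow (by positivity) (by positivity)

theorem mem_lowerExponents {Φ : ℝ → ℝ} (hΦ : IsLarge Φ) {l : ℕ → U × Weights K}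
    (hl : ∀ k i, 0 < (l k).2.1 i) {d L : ℝ} (hd : 0 ≤ d) (hL : 0 ≤ L)
    (h : ∃ n₀, ∀ n ≥ n₀, ∀ m, n + gap L n ≤ m → ∀ ω : ℕ → Fin K,
      0 ≤ ∑ k ∈ Finset.Ico n m, M.score d (l k) (ω k)) :
    d ∈ lowerExponents Φ (M.moranMeasure l) := by
  obtain ⟨n₀, h⟩ := h
  have hA := M.A_pos
  have hτ := M.τ_pos
  have hτ1 := τ_lt_one (M := M)
  obtain ⟨δ, hδ, hscale⟩ := mem_nhdsGT_iff_exists_Ioo_subset.1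
    (hΦ.rpow_le hA A_lt_one (B_pos (M := M)) M.B_lt_one (mul_pos hτ hA) hL)
  have hδ : 0 < δ := hδ
  set u : ℕ → U := fun k => (l k).1 with hu
  have hAn : M.A ^ n₀ ≤ 1 := pow_le_one₀ hA.le A_lt_one.le
  refine ⟨min (δ / 2) (M.τ * M.A ^ n₀), by positivity, ?_, (M.τ * M.A ^ 2) ^ d,
    by positivity, ?_⟩
  · refine (min_le_right _ _).trans_lt ?_
    nlinarith
  intro r R hr hrR hRR hR0 hRC x hx
  obtain ⟨ω, hω⟩ := exists_address hx
  have hAn0 : 0 < M.A ^ n₀ := by positivity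
  have hR1 : R ≤ M.τ * M.A ^ n₀ := hRC.trans (min_le_right _ _)
  have hR2 : R ≤ M.A ^ n₀ := by nlinarith
  have hrτ : r / M.τ ≤ 1 := by rw [div_le_one hτ]; nlinarith
  obtain ⟨n, hn1, hn2⟩ := exists_len_scale (M := M) u ω hR0 (hR2.trans hAn)
  obtain ⟨m, hm1, hm2⟩ := exists_len_scale (M := M) u ω (div_pos hr hτ) hrτ
  have hn0 : n₀ ≤ n + 1 := by
    by_contra! hlt
    have h1 := len_antitone (M := M) u ω hlt.le
    have h2 := A_pow_le_len (M := M) u ω n₀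
    linarith
  have hRn : M.A * R ≤ M.len u ω (n + 1) :=
    (mul_le_mul_of_nonneg_left hn2 hA.le).trans (A_mul_len_le u ω n)
  have hgap : (n + 1) + gap L (n + 1) ≤ m := by
    by_contra! hlt
    have h1 := hscale (a := R) ⟨hR0, hRC.trans_lt ((min_le_left _ _).trans_lt (by linarith))⟩
      (n + 1) (hRn.trans (len_le_B_pow u ω _))
    have h2 := A_pow_mul_len_le (M := M) u ω (n + 1) (gap L (n + 1))
    have h3 := len_antitone (M := M) u ω (Nat.succ_le_of_lt hlt)
    have h4 : M.A ^ gap L (n + 1) * (M.A * R) ≤ M.A ^ gap L (n + 1) * M.len u ω (n + 1) := by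
      gcongr
    have h5 : r / M.τ < M.A ^ gap L (n + 1) * (M.A * R) := by
      rw [div_lt_iff₀ hτ]
      linarith
    simp only [Nat.succ_eq_add_one] at h3
    linarith
  have hlenm := len_pos (M := M) u ω m
  have hlenn := len_pos (M := M) u ω (n + 1)
  calc _ = (M.τ * M.A ^ 2 * (R / r)) ^ d := (Real.mul_rpow (by positivity) (by positivity)).symm
    _ ≤ (M.len u ω (n + 1) / M.len u ω m) ^ d := by
        refine Real.rpow_le_rpow (by positivity) ?_ hd
        have h2 := A_mul_len_le (M := M) u ω m
        have h4 : M.len u ω m ≤ r / (M.τ * M.A) := by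
          rw [lt_div_iff₀ hτ] at hm1
          rw [le_div_iff₀ (by positivity)]
          nlinarith
        calc _ = M.A * R / (r / (M.τ * M.A)) := by field_simp
          _ ≤ _ := by gcongr
    _ ≤ mass l ω (n + 1) / mass l ω m := by
        rw [mass_div_mass (M := M) hl d ω (by omega)]
        refine le_mul_of_one_le_left (by positivity) ?_
        exact Real.one_le_exp_iff.2 (h _ hn0 _ hgap ω)
    _ ≤ _ := by
        refine div_le_div₀ measureReal_nonneg ?_ (ball_pos hl hω hr) ?_
        · exact mass_le_ball l (hω _) hn1
        · exact ball_le_mass l (hω m) (by rw [div_le_iff₀ hτ] at hm2; linarith)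

/-- A point with address `ω` violates the condition as soon as the scores along `ω` sum to
infinity: fix the large radius and let the small one tend to zero. -/
theorem notMem_upperExponents {Φ : ℝ → ℝ} (hΦ : ∀ t ∈ Ioo (0 : ℝ) 1, 0 ≤ Φ t)
    {l : ℕ → U × Weights K} (hl : ∀ k i, 0 < (l k).2.1 i) {d : ℝ} (ω : ℕ → Fin K)
    (h : Tendsto (fun m => ∑ k ∈ Finset.range m, M.score d (l k) (ω k)) atTop atTop) :
    d ∉ upperExponents Φ (M.moranMeasure l) := by
  rintro ⟨C₁, hC0, hC1, C₂, hC2, H⟩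
  have hτ := M.τ_pos
  set u : ℕ → U := fun k => (l k).1 with hu
  obtain ⟨n, hn⟩ := ((len_tendsto (M := M) u ω).eventually
    (gt_mem_nhds (show 0 < C₁ / 2 by positivity))).exists
  have hlenn := len_pos (M := M) u ω n
  set R := 2 * M.len u ω n with hR
  have hR0 : 0 < R := by positivity
  have hRC : R ≤ C₁ := by linarith
  have hRR : R ^ (1 + Φ R) ≤ R := by
    refine Real.rpow_le_self_of_le_one hR0.le (by linarith) ?_
    linarith [hΦ R ⟨hR0, by linarith⟩]
  have e1 : ∀ᶠ m in atTop, M.τ * M.len u ω m < R ^ (1 + Φ R) := by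
    have := (len_tendsto (M := M) u ω).const_mul M.τ
    rw [mul_zero] at this
    exact this.eventually (gt_mem_nhds (by positivity))
  obtain ⟨m, hm1, hm2, hm3⟩ := (e1.and ((eventually_ge_atTop n).and (h.eventually_gt_atTop
    (∑ k ∈ Finset.range n, M.score d (l k) (ω k) + Real.log (C₂ * (2 / M.τ) ^ d))))).exists
  have hlenm := len_pos (M := M) u ω m
  have hx := code_mem (M := M) u ω
  have h1 := H (M.τ * M.len u ω m) R (by positivity) hm1 hRR hR0 hRC _ (code_mem_support hl ω)
  have h2 : mass l ω n / mass l ω m ≤ C₂ * (R / (M.τ * M.len u ω m)) ^ d := by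
    refine le_trans ?_ h1
    refine div_le_div₀ measureReal_nonneg ?_ (ball_pos hl hx (by positivity)) ?_
    · exact mass_le_ball l (hx n) (by linarith)
    · exact ball_le_mass l (hx m) le_rfl
  rw [mass_div_mass (M := M) hl d ω hm2, show R / (M.τ * M.len u ω m) =
    2 / M.τ * (M.len u ω n / M.len u ω m) by rw [hR]; field_simp,
    Real.mul_rpow (by positivity) (by positivity), ← mul_assoc] at h2
  have h3 := le_of_mul_le_mul_right h2 (by positivity)
  rw [← Real.le_log_iff_exp_le (by positivity)] at h3
  have h4 := Finset.sum_range_add_sum_Ico (fun k => M.score d (l k) (ω k)) hm2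
  linarith

theorem notMem_lowerExponents {Φ : ℝ → ℝ} (hΦ : ∀ t ∈ Ioo (0 : ℝ) 1, 0 ≤ Φ t)
    {l : ℕ → U × Weights K} (hl : ∀ k i, 0 < (l k).2.1 i) {d : ℝ} (ω : ℕ → Fin K)
    (h : Tendsto (fun m => ∑ k ∈ Finset.range m, M.score d (l k) (ω k)) atTop atBot) :
    d ∉ lowerExponents Φ (M.moranMeasure l) := by
  rintro ⟨C₁, hC0, hC1, C₂, hC2, H⟩
  have hτ := M.τ_pos
  have hτ1 := τ_lt_one (M := M)
  set u : ℕ → U := fun k => (l k).1 with hu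
  obtain ⟨n, hn⟩ := ((len_tendsto (M := M) u ω).eventually (gt_mem_nhds hC0)).exists
  have hlenn := len_pos (M := M) u ω n
  set R := M.τ * M.len u ω n with hR
  have hR0 : 0 < R := by positivity
  have hRC : R ≤ C₁ := by nlinarith
  have hRR : R ^ (1 + Φ R) ≤ R := by
    refine Real.rpow_le_self_of_le_one hR0.le (by linarith) ?_
    linarith [hΦ R ⟨hR0, by linarith⟩]
  have e1 : ∀ᶠ m in atTop, 2 * M.len u ω m < R ^ (1 + Φ R) := by
    have := (len_tendsto (M := M) u ω).const_mul 2
    rw [mul_zero] at this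
    exact this.eventually (gt_mem_nhds (by positivity))
  obtain ⟨m, hm1, hm2, hm3⟩ := (e1.and ((eventually_ge_atTop n).and (h.eventually_lt_atBot
    (∑ k ∈ Finset.range n, M.score d (l k) (ω k) + Real.log (C₂ * (M.τ / 2) ^ d))))).exists
  have hlenm := len_pos (M := M) u ω m
  have hx := code_mem (M := M) u ω
  have h1 := H (2 * M.len u ω m) R (by positivity) hm1 hRR hR0 hRC _ (code_mem_support hl ω)
  have h2 : C₂ * (R / (2 * M.len u ω m)) ^ d ≤ mass l ω n / mass l ω m := by
    refine h1.trans ?_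
    refine div_le_div₀ (mass_pos hl ω n).le ?_ (mass_pos hl ω m) ?_
    · exact ball_le_mass l (hx n) le_rfl
    · exact mass_le_ball l (hx m) (by linarith)
  rw [mass_div_mass (M := M) hl d ω hm2, show R / (2 * M.len u ω m) =
    M.τ / 2 * (M.len u ω n / M.len u ω m) by rw [hR]; field_simp,
    Real.mul_rpow (by positivity) (by positivity), ← mul_assoc] at h2
  have h3 := le_of_mul_le_mul_right h2 (by positivity)
  rw [← Real.log_le_iff_le_exp (by positivity)] at h3
  have h4 := Finset.sum_range_add_sum_Ico (fun k => M.score d (l k) (ω k)) hm2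
  linarith

end IFSFamily

end RandomMoran

namespace RandomMoran

/-! ### Sums of independent variables with negative mean over long windows -/

/-- A Chernoff bound: a variable with negative mean and an exponential moment has a Laplace
transform less than one at some positive argument, with room for a small drift. -/
theorem exists_mgf_lt_one {E : Type*} [MeasurableSpace E] {ν : Measure E} [IsProbabilityMeasure ν]
    {Y : E → ℝ} (hY : Measurable Y) {t : ℝ} (ht : 0 < t)
    (hint : Integrable (fun z => Real.exp (t * |Y z|)) ν) (hneg : ∫ z, Y z ∂ν < 0) :
    ∃ θ > 0, ∃ ε > 0, Integrable (fun z => Real.exp (θ * Y z)) ν ∧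
      Real.exp (θ * ε) * ProbabilityTheory.mgf Y ν θ < 1 := by
  have hexp : ∀ s ∈ Ioo (-t) t, Integrable (fun z => Real.exp (s * Y z)) ν := by
    intro s hs
    refine hint.mono' (by fun_prop) (ae_of_all _ fun z => ?_)
    rw [Real.norm_of_nonneg (Real.exp_pos _).le, Real.exp_le_exp]
    have h1 : |s| ≤ t := abs_le.2 ⟨hs.1.le, hs.2.le⟩
    calc s * Y z ≤ |s * Y z| := le_abs_self _
      _ = |s| * |Y z| := abs_mul _ _
      _ ≤ _ := by gcongr
  have h0 : (0 : ℝ) ∈ interior (ProbabilityTheory.integrableExpSet Y ν) := by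
    refine mem_interior.2 ⟨Ioo (-t) t, fun s hs => hexp s hs, isOpen_Ioo, ?_, ht⟩
    linarith
  have hder := ProbabilityTheory.hasDerivAt_mgf h0
  simp only [zero_mul, Real.exp_zero, mul_one] at hder
  -- the Laplace transform is one at `0` and has negative derivative there
  have hlt : ∀ᶠ θ in 𝓝[>] (0 : ℝ), ProbabilityTheory.mgf Y ν θ < 1 := by
    have h1 := (hasDerivAt_iff_tendsto_slope.1 hder).mono_left
      (nhdsWithin_mono 0 (fun x (hx : 0 < x) => hx.ne'))
    filter_upwards [h1.eventually (gt_mem_nhds hneg), self_mem_nhdsWithin] with θ hθ hθ0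
    have hθ0 : 0 < θ := hθ0
    rw [slope_def_field, sub_zero, div_lt_iff₀ hθ0, zero_mul, ProbabilityTheory.mgf_zero] at hθ
    linarith
  obtain ⟨θ, ⟨hθ1, hθt⟩, hθ0⟩ := ((hlt.and (nhdsWithin_le_nhds (gt_mem_nhds ht))).and
    self_mem_nhdsWithin).exists
  have hθ0 : 0 < θ := hθ0
  have hcont : Tendsto (fun ε => Real.exp (θ * ε) * ProbabilityTheory.mgf Y ν θ) (𝓝[>] 0)
      (𝓝 (Real.exp (θ * 0) * ProbabilityTheory.mgf Y ν θ)) := by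
    refine Tendsto.mono_left ?_ nhdsWithin_le_nhds
    exact Continuous.tendsto (by fun_prop) 0
  rw [mul_zero, Real.exp_zero, one_mul] at hcont
  obtain ⟨ε, hε, hε0⟩ := ((hcont.eventually (gt_mem_nhds hθ1)).and self_mem_nhdsWithin).exists
  exact ⟨θ, hθ0, ε, hε0, hexp θ ⟨by linarith, hθt⟩, hε⟩

/-- Almost surely, all sums over windows `[n, m)` with `n` large and `m - n` at least a constant
times `log n` are negative, and at most a negative multiple of the length of the window. -/
theorem exists_ae_window_sum_le {E : Type*} [MeasurableSpace E] {ν : Measure E}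
    [IsProbabilityMeasure ν] {Y : E → ℝ} (hY : Measurable Y) {t : ℝ} (ht : 0 < t)
    (hint : Integrable (fun z => Real.exp (t * |Y z|)) ν) (hneg : ∫ z, Y z ∂ν < 0) :
    ∃ ε > 0, ∃ L : ℝ, 0 ≤ L ∧ ∀ᵐ l ∂(Measure.infinitePi fun _ : ℕ => ν), ∃ n₀ : ℕ, ∀ n ≥ n₀,
      ∀ m, n + gap L n ≤ m → ∑ k ∈ Finset.Ico n m, Y (l k) ≤ -(ε * ((m : ℝ) - n)) := by
  obtain ⟨θ, hθ, ε, hε, hexp, hlt⟩ := exists_mgf_lt_one hY ht hint hneg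
  set ρ := Real.exp (θ * ε) * ProbabilityTheory.mgf Y ν θ with hρd
  set P := Measure.infinitePi fun _ : ℕ => ν with hP
  have hmgf : 0 < ProbabilityTheory.mgf Y ν θ := ProbabilityTheory.mgf_pos hexp
  have hρ : 0 < ρ := by positivity
  have hlog : Real.log ρ < 0 := Real.log_neg hρ hlt
  have hindep : ProbabilityTheory.iIndepFun (fun k (l : ℕ → E) => Y (l k)) P :=
    ProbabilityTheory.iIndepFun_infinitePi (X := fun _ => Y) fun _ => hY
  have hYm : ∀ k, Measurable fun l : ℕ → E => Y (l k) := fun k => hY.comp (measurable_pi_apply k)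
  have hmp : ∀ k, MeasurePreserving (Function.eval k) P ν := fun k =>
    measurePreserving_eval_infinitePi (fun _ : ℕ => ν) k
  have hexpk : ∀ k, Integrable (fun l : ℕ → E => Real.exp (θ * Y (l k))) P := fun k =>
    (hmp k).integrable_comp_of_integrable hexp
  have hmgfk : ∀ k, ProbabilityTheory.mgf (fun l : ℕ → E => Y (l k)) P θ =
      ProbabilityTheory.mgf Y ν θ := by
    intro k
    rw [ProbabilityTheory.mgf, ProbabilityTheory.mgf, ← (hmp k).map_eq,
      integral_map (hmp k).measurable.aemeasurable (by fun_prop)]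
  have hbad : ∀ n j : ℕ, P.real {l | -(ε * j) ≤ ∑ k ∈ Finset.Ico n (n + j), Y (l k)} ≤ ρ ^ j := by
    intro n j
    have h1 := ProbabilityTheory.measure_ge_le_exp_mul_mgf (μ := P)
      (X := ∑ k ∈ Finset.Ico n (n + j), fun l : ℕ → E => Y (l k)) (-(ε * j)) hθ.le
      (hindep.integrable_exp_mul_sum hYm fun k _ => hexpk k)
    rw [hindep.mgf_sum hYm, Finset.prod_congr rfl fun k _ => hmgfk k, Finset.prod_const,
      Nat.card_Ico, Nat.add_sub_cancel_left] at h1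
    simp only [Finset.sum_apply] at h1
    refine h1.trans (le_of_eq ?_)
    rw [hρd, mul_pow, ← Real.exp_nat_mul]
    congr 2
    ring
  -- with this `L` the geometric tails are at most a multiple of `(n + 1) ^ (-2)`
  set L := 2 / -Real.log ρ with hL
  have hL0 : 0 ≤ L := by have := neg_pos.2 hlog; positivity
  refine ⟨ε, hε, L, hL0, ?_⟩
  set s : ℕ → Set (ℕ → E) := fun n =>
    ⋃ j : ℕ, {l | -(ε * ((gap L n + j : ℕ) : ℝ)) ≤
      ∑ k ∈ Finset.Ico n (n + (gap L n + j)), Y (l k)} with hs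
  have hgapn : ∀ n : ℕ, ρ ^ gap L n ≤ 1 / ((n : ℝ) + 1) ^ 2 := by
    intro n
    have hn : (0 : ℝ) < (n : ℝ) + 1 := by positivity
    rw [← Real.log_le_log_iff (by positivity) (by positivity), Real.log_pow, one_div, Real.log_inv,
      Real.log_pow]
    have h1 : L * Real.log (n + 1) ≤ gap L n := Nat.le_ceil _
    have h2 := mul_le_mul_of_nonpos_right h1 hlog.le
    have h3 : L * Real.log ρ = -2 := by
      have := hlog.ne
      rw [hL]
      field_simp
    push_cast
    calc _ ≤ _ := h2
      _ = L * Real.log ρ * Real.log (n + 1) := by ring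
      _ = _ := by rw [h3]; ring
  have hgeo : Summable fun j : ℕ => ρ ^ j := summable_geometric_of_lt_one hρ.le hlt
  have hsn : ∀ n, P (s n) ≤ ENNReal.ofReal (1 / ((n : ℝ) + 1) ^ 2 * (1 - ρ)⁻¹) := by
    intro n
    calc P (s n) ≤ ∑' j : ℕ, P {l | -(ε * ((gap L n + j : ℕ) : ℝ)) ≤
          ∑ k ∈ Finset.Ico n (n + (gap L n + j)), Y (l k)} := measure_iUnion_le _
      _ ≤ ∑' j : ℕ, ENNReal.ofReal (ρ ^ gap L n * ρ ^ j) := by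
          refine ENNReal.tsum_le_tsum fun j => ?_
          rw [← ofReal_measureReal, ← pow_add]
          exact ENNReal.ofReal_le_ofReal (hbad n _)
      _ = ENNReal.ofReal (ρ ^ gap L n * (1 - ρ)⁻¹) := by
          rw [← ENNReal.ofReal_tsum_of_nonneg (fun j => by positivity) (hgeo.mul_left _),
            tsum_mul_left, tsum_geometric_of_lt_one hρ.le hlt]
      _ ≤ _ := by
          have : 0 < 1 - ρ := by linarith
          exact ENNReal.ofReal_le_ofReal (mul_le_mul_of_nonneg_right (hgapn n) (by positivity))
  have hsum : ∑' n, P (s n) ≠ ∞ := by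
    refine ne_top_of_le_ne_top ?_ (ENNReal.tsum_le_tsum hsn)
    have h1 : Summable fun n : ℕ => 1 / ((n : ℝ) + 1) ^ 2 := by
      have := (summable_nat_add_iff 1).2 (Real.summable_one_div_nat_pow.2 (one_lt_two))
      simpa using this
    exact (h1.mul_right _).tsum_ofReal_ne_top
  filter_upwards [ae_eventually_notMem hsum] with l hl
  obtain ⟨n₀, hn₀⟩ := eventually_atTop.1 hl
  refine ⟨n₀, fun n hn m hm => ?_⟩
  obtain ⟨j, rfl⟩ := Nat.exists_eq_add_of_le hm
  have h1 := hn₀ n hn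
  simp only [hs, mem_iUnion, mem_ofPred_eq, not_exists, not_le] at h1
  have h2 := (h1 j).le
  rw [← add_assoc] at h2
  refine h2.trans (le_of_eq ?_)
  push_cast
  ring

/-- Under the same conditions the full sums tend to `-∞`. -/
theorem ae_sum_tendsto_atBot {E : Type*} [MeasurableSpace E] {ν : Measure E}
    [IsProbabilityMeasure ν] {Y : E → ℝ} (hY : Measurable Y) {t : ℝ} (ht : 0 < t)
    (hint : Integrable (fun z => Real.exp (t * |Y z|)) ν) (hneg : ∫ z, Y z ∂ν < 0) :
    ∀ᵐ l ∂(Measure.infinitePi fun _ : ℕ => ν),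
      Tendsto (fun m => ∑ k ∈ Finset.range m, Y (l k)) atTop atBot := by
  obtain ⟨ε, hε, L, -, h⟩ := exists_ae_window_sum_le hY ht hint hneg
  filter_upwards [h] with l ⟨n, hn⟩
  have h1 : Tendsto (fun m : ℕ => ∑ k ∈ Finset.range n, Y (l k) + -(ε * ((m : ℝ) - n)))
      atTop atBot := by
    refine tendsto_atBot_add_const_left _ _ (tendsto_neg_atTop_atBot.comp ?_)
    refine Tendsto.const_mul_atTop hε ?_
    simpa only [sub_eq_add_neg] using
      tendsto_atTop_add_const_right _ (-(n : ℝ)) tendsto_natCast_atTop_atTop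
  refine tendsto_atBot_mono' _ ?_ h1
  filter_upwards [eventually_ge_atTop (n + gap L n)] with m hm
  have h2 := hn n le_rfl m hm
  rw [← Finset.sum_range_add_sum_Ico _ (show n ≤ m by omega)]
  linarith

end RandomMoran

namespace RandomMoran

/-! ### Integrability of the weights -/

theorem weight_le_one {K : ℕ} (p : Weights K) (i : Fin K) : p.1 i ≤ 1 := by
  rw [← p.2.2]
  exact Finset.single_le_sum (fun j _ => p.2.1 j) (Finset.mem_univ i)

theorem measurable_weight {K : ℕ} (i : Fin K) : Measurable fun p : Weights K => p.1 i :=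
  (measurable_pi_apply i).comp measurable_subtype_coe

theorem IsValid.pos {K : ℕ} {p : Weights K} (hp : IsValid p) (i : Fin K) : 0 < p.1 i :=
  (p.2.1 i).lt_of_ne' (hp i)

theorem Admissible.ae_pos {K : ℕ} {R : ProbabilityMeasure (Weights K)} (hR : Admissible R) :
    ∀ᵐ p ∂(R : Measure (Weights K)), ∀ i, 0 < p.1 i := by
  obtain ⟨t, ht, h⟩ := hR
  refine ae_all_iff.2 fun i => ?_
  have hm : Measurable fun p : Weights K => ENNReal.ofReal (p.1 i) ^ (-t) :=
    (ENNReal.measurable_ofReal.comp (measurable_weight i)).pow_const _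
  filter_upwards [ae_lt_top hm (h i).ne] with p hp
  by_contra hneg
  rw [ENNReal.ofReal_eq_zero.2 (not_lt.1 hneg), ENNReal.zero_rpow_of_neg (neg_lt_zero.2 ht)] at hp
  exact lt_irrefl _ hp

theorem Admissible.exists_integrable_rpow {K : ℕ} {R : ProbabilityMeasure (Weights K)}
    (hR : Admissible R) : ∃ t : ℝ, 0 < t ∧
      ∀ i, Integrable (fun p : Weights K => p.1 i ^ (-t)) (R : Measure (Weights K)) := by
  have hpos := hR.ae_pos
  obtain ⟨t, ht, h⟩ := hR
  refine ⟨t, ht, fun i => ⟨((measurable_weight i).pow_const _).aestronglyMeasurable, ?_⟩⟩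
  rw [hasFiniteIntegral_iff_ofReal (ae_of_all _ fun p => Real.rpow_nonneg (p.2.1 i) _)]
  refine lt_of_le_of_lt (le_of_eq ?_) (h i)
  refine lintegral_congr_ae ?_
  filter_upwards [hpos] with p hp
  rw [ENNReal.ofReal_rpow_of_pos (hp i)]

theorem IsValid.admissible_single {K : ℕ} {p : Weights K} (hp : IsValid p) :
    Admissible (single p) := by
  refine ⟨1, one_pos, fun i => ?_⟩
  have hm : Measurable fun p : Weights K => ENNReal.ofReal (p.1 i) ^ (-1 : ℝ) :=
    (ENNReal.measurable_ofReal.comp (measurable_weight i)).pow_const _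
  change ∫⁻ p, ENNReal.ofReal (p.1 i) ^ (-1 : ℝ) ∂(Measure.dirac p) < ∞
  rw [lintegral_dirac' _ hm]
  rw [ENNReal.ofReal_rpow_of_pos (hp.pos i)]
  exact ENNReal.ofReal_lt_top

namespace IFSFamily

variable {U : Type*} [MeasurableSpace U] {K : ℕ} {M : IFSFamily U K}

/-! ### Extremal scores -/

variable (M) in
/-- The largest score of a branch. -/
noncomputable def maxScore (d : ℝ) (z : U × Weights K) : ℝ := ⨆ i, M.score d z i

variable (M) in
/-- The smallest score of a branch. -/
noncomputable def minScore (d : ℝ) (z : U × Weights K) : ℝ := ⨅ i, M.score d z i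

variable (M) in
/-- The properties common to the largest and the smallest score. -/
structure IsExtremalScore (G : ℝ → U × Weights K → ℝ) : Prop where
  measurable : ∀ d, Measurable (G d)
  attained : ∀ d z, ∃ i, G d z = M.score d z i
  add_le : ∀ d e, d ≤ e → ∀ z, G d z + (e - d) * Real.log M.A ≤ G e z
  le_add : ∀ d e, d ≤ e → ∀ z, G e z ≤ G d z + (e - d) * Real.log M.B
  le_add_sum : ∀ d u p q, G d (u, p) ≤ G d (u, q) + ∑ i, |Real.log (p.1 i) - Real.log (q.1 i)|

theorem score_le_maxScore (d : ℝ) (z : U × Weights K) (i : Fin K) :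
    M.score d z i ≤ M.maxScore d z :=
  le_ciSup (Set.finite_range _).bddAbove i

theorem minScore_le_score (d : ℝ) (z : U × Weights K) (i : Fin K) :
    M.minScore d z ≤ M.score d z i :=
  ciInf_le (Set.finite_range _).bddBelow i

theorem nonempty_fin (M : IFSFamily U K) : Nonempty (Fin K) := ⟨⟨0, by have := M.two_le; omega⟩⟩

theorem exists_score_eq_maxScore (d : ℝ) (z : U × Weights K) :
    ∃ i, M.score d z i = M.maxScore d z :=
  have := nonempty_fin M
  exists_eq_ciSup_of_finite

theorem exists_score_eq_minScore (d : ℝ) (z : U × Weights K) :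
    ∃ i, M.score d z i = M.minScore d z :=
  have := nonempty_fin M
  exists_eq_ciInf_of_finite

theorem log_A_neg : Real.log M.A < 0 := Real.log_neg M.A_pos A_lt_one

theorem log_B_neg : Real.log M.B < 0 := Real.log_neg B_pos M.B_lt_one

theorem log_A_le (i : Fin K) (u : U) : Real.log M.A ≤ Real.log (M.a i u) :=
  Real.log_le_log M.A_pos (M.A_le i u)

theorem log_a_le (i : Fin K) (u : U) : Real.log (M.a i u) ≤ Real.log M.B :=
  Real.log_le_log (a_pos i u) (a_le_B i u)

theorem measurable_score (d : ℝ) (i : Fin K) : Measurable fun z => M.score d z i :=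
  ((Real.measurable_log.comp ((M.measurable_a i).comp measurable_fst)).const_mul d).sub
    (Real.measurable_log.comp ((measurable_weight i).comp measurable_snd))

theorem score_add_le {d e : ℝ} (h : d ≤ e) (z : U × Weights K) (i : Fin K) :
    M.score d z i + (e - d) * Real.log M.A ≤ M.score e z i := by
  have := mul_le_mul_of_nonneg_left (log_A_le (M := M) i z.1) (sub_nonneg.2 h)
  simp only [score]
  linarith

theorem score_le_add {d e : ℝ} (h : d ≤ e) (z : U × Weights K) (i : Fin K) :
    M.score e z i ≤ M.score d z i + (e - d) * Real.log M.B := by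
  have := mul_le_mul_of_nonneg_left (log_a_le (M := M) i z.1) (sub_nonneg.2 h)
  simp only [score]
  linarith

theorem score_le_add_sum (d : ℝ) (u : U) (p q : Weights K) (i : Fin K) :
    M.score d (u, p) i ≤
      M.score d (u, q) i + ∑ i, |Real.log (p.1 i) - Real.log (q.1 i)| := by
  have h1 := Finset.single_le_sum (f := fun i => |Real.log (p.1 i) - Real.log (q.1 i)|)
    (fun j _ => abs_nonneg _) (Finset.mem_univ i)
  have h2 := neg_abs_le (Real.log (p.1 i) - Real.log (q.1 i))
  simp only [score]
  linarith

variable (M) in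
theorem isExtremalScore_maxScore : M.IsExtremalScore M.maxScore where
  measurable d := Measurable.iSup fun i => measurable_score d i
  attained d z := (exists_score_eq_maxScore d z).imp fun _ h => h.symm
  add_le d e h z := by
    obtain ⟨i, hi⟩ := exists_score_eq_maxScore (M := M) d z
    rw [← hi]
    exact (score_add_le h z i).trans (score_le_maxScore e z i)
  le_add d e h z := by
    obtain ⟨i, hi⟩ := exists_score_eq_maxScore (M := M) e z
    rw [← hi]
    exact (score_le_add h z i).trans (add_le_add_left (score_le_maxScore d z i) _)
  le_add_sum d u p q := by
    obtain ⟨i, hi⟩ := exists_score_eq_maxScore (M := M) d (u, p)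
    rw [← hi]
    exact (score_le_add_sum d u p q i).trans (add_le_add_left (score_le_maxScore d _ i) _)

variable (M) in
theorem isExtremalScore_minScore : M.IsExtremalScore M.minScore where
  measurable d := Measurable.iInf fun i => measurable_score d i
  attained d z := (exists_score_eq_minScore d z).imp fun _ h => h.symm
  add_le d e h z := by
    obtain ⟨i, hi⟩ := exists_score_eq_minScore (M := M) e z
    rw [← hi]
    exact (add_le_add_left (minScore_le_score d z i) _).trans (score_add_le h z i)
  le_add d e h z := by
    obtain ⟨i, hi⟩ := exists_score_eq_minScore (M := M) d z
    rw [← hi]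
    exact (minScore_le_score e z i).trans (score_le_add h z i)
  le_add_sum d u p q := by
    obtain ⟨i, hi⟩ := exists_score_eq_minScore (M := M) d (u, q)
    rw [← hi]
    exact (minScore_le_score d _ i).trans (score_le_add_sum d u p q i)

/-! ### Mean extremal scores -/

namespace IsExtremalScore

variable {G : ℝ → U × Weights K → ℝ} (hG : M.IsExtremalScore G)
  {Q : Measure U} [IsProbabilityMeasure Q] {R : ProbabilityMeasure (Weights K)}

include hG

theorem exp_abs_le (d : ℝ) {t : ℝ} (ht : 0 ≤ t) {z : U × Weights K} (hz : ∀ i, 0 < z.2.1 i) :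
    Real.exp (t * |G d z|) ≤
      Real.exp (t * (|d| * -Real.log M.A)) * ∑ i, z.2.1 i ^ (-t) := by
  obtain ⟨i, hi⟩ := hG.attained d z
  have h1 : |Real.log (M.a i z.1)| ≤ -Real.log M.A := by
    rw [abs_of_nonpos ((log_a_le i z.1).trans log_B_neg.le)]
    exact neg_le_neg (log_A_le i z.1)
  have h2 : |Real.log (z.2.1 i)| = -Real.log (z.2.1 i) :=
    abs_of_nonpos (Real.log_nonpos (hz i).le (weight_le_one _ i))
  have h3 : |G d z| ≤ |d| * -Real.log M.A + -Real.log (z.2.1 i) := by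
    rw [hi, score, ← h2]
    refine (abs_sub _ _).trans ?_
    rw [abs_mul]
    gcongr
  calc Real.exp (t * |G d z|)
      ≤ Real.exp (t * (|d| * -Real.log M.A + -Real.log (z.2.1 i))) := by gcongr
    _ = Real.exp (t * (|d| * -Real.log M.A)) * z.2.1 i ^ (-t) := by
        rw [mul_add, Real.exp_add, Real.rpow_def_of_pos (hz i)]
        congr 2
        ring
    _ ≤ _ := by
        gcongr
        exact Finset.single_le_sum (f := fun i => z.2.1 i ^ (-t))
          (fun j _ => Real.rpow_nonneg (z.2.2.1 j) _) (Finset.mem_univ i)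

theorem exists_integrable_exp (hR : Admissible R) (d : ℝ) :
    ∃ t : ℝ, 0 < t ∧ Integrable (fun z => Real.exp (t * |G d z|))
      (Q.prod (R : Measure (Weights K))) := by
  obtain ⟨t, ht, h⟩ := hR.exists_integrable_rpow
  refine ⟨t, ht, ?_⟩
  have h1 : Integrable (fun z : U × Weights K => ∑ i, z.2.1 i ^ (-t))
      (Q.prod (R : Measure (Weights K))) :=
    integrable_finsetSum _ fun i _ => (h i).comp_snd Q
  have hm := hG.measurable d
  refine (h1.const_mul (Real.exp (t * (|d| * -Real.log M.A)))).mono' (by fun_prop) ?_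
  filter_upwards [(Measure.quasiMeasurePreserving_snd (μ := Q)).ae hR.ae_pos] with z hz
  rw [Real.norm_of_nonneg (Real.exp_pos _).le]
  exact hG.exp_abs_le d ht.le hz

theorem integrable (hR : Admissible R) (d : ℝ) :
    Integrable (G d) (Q.prod (R : Measure (Weights K))) := by
  obtain ⟨t, ht, h⟩ := hG.exists_integrable_exp (Q := Q) hR d
  refine (h.const_mul t⁻¹).mono' (hG.measurable d).aestronglyMeasurable (ae_of_all _ fun z => ?_)
  rw [Real.norm_eq_abs, inv_mul_eq_div, le_div_iff₀ ht]
  linarith [Real.add_one_le_exp (t * |G d z|)]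

theorem integral_add_le (hR : Admissible R) {d e : ℝ} (h : d ≤ e) :
    ∫ z, G d z ∂(Q.prod (R : Measure (Weights K))) + (e - d) * Real.log M.A ≤
      ∫ z, G e z ∂(Q.prod (R : Measure (Weights K))) := by
  have h1 := integral_mono ((hG.integrable (Q := Q) hR d).add
    (integrable_const ((e - d) * Real.log M.A))) (hG.integrable hR e) (hG.add_le d e h)
  have h2 := integral_add (hG.integrable (Q := Q) hR d)
    (integrable_const ((e - d) * Real.log M.A))
  rw [integral_const, probReal_univ, one_smul] at h2
  exact h2.symm.le.trans h1

theorem integral_le_add (hR : Admissible R) {d e : ℝ} (h : d ≤ e) :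
    ∫ z, G e z ∂(Q.prod (R : Measure (Weights K))) ≤
      ∫ z, G d z ∂(Q.prod (R : Measure (Weights K))) + (e - d) * Real.log M.B := by
  have h1 := integral_mono (hG.integrable hR e) ((hG.integrable (Q := Q) hR d).add
    (integrable_const ((e - d) * Real.log M.B))) (hG.le_add d e h)
  have h2 := integral_add (hG.integrable (Q := Q) hR d)
    (integrable_const ((e - d) * Real.log M.B))
  rw [integral_const, probReal_univ, one_smul] at h2
  exact h1.trans h2.le

theorem integral_anti (hR : Admissible R) {d e : ℝ} (h : d ≤ e) :
    ∫ z, G e z ∂(Q.prod (R : Measure (Weights K))) ≤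
      ∫ z, G d z ∂(Q.prod (R : Measure (Weights K))) := by
  have := hG.integral_le_add (Q := Q) hR h
  nlinarith [log_B_neg (M := M)]

theorem integral_strictAnti (hR : Admissible R) {d e : ℝ} (h : d < e) :
    ∫ z, G e z ∂(Q.prod (R : Measure (Weights K))) <
      ∫ z, G d z ∂(Q.prod (R : Measure (Weights K))) := by
  have := hG.integral_le_add (Q := Q) hR h.le
  nlinarith [log_B_neg (M := M)]

/-- At nonpositive exponents all scores are positive, since every weight is less than one. -/
theorem integral_pos (hR : Admissible R) {d : ℝ} (hd : d ≤ 0) :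
    0 < ∫ z, G d z ∂(Q.prod (R : Measure (Weights K))) := by
  refine lt_of_lt_of_le ?_ (hG.integral_anti hR hd)
  have hpos : ∀ᵐ z ∂(Q.prod (R : Measure (Weights K))), 0 < G 0 z := by
    filter_upwards [(Measure.quasiMeasurePreserving_snd (μ := Q)).ae hR.ae_pos] with z hz
    obtain ⟨i, hi⟩ := hG.attained 0 z
    rw [hi, score, zero_mul, zero_sub, neg_pos]
    have : Nontrivial (Fin K) := Fin.nontrivial_iff_two_le.2 M.two_le
    obtain ⟨j, hj⟩ := exists_ne i
    refine Real.log_neg (hz i) ?_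
    have h1 := Finset.add_le_sum (fun k _ => z.2.2.1 k) (Finset.mem_univ i) (Finset.mem_univ j)
      hj.symm
    rw [z.2.2.2] at h1
    linarith [hz j]
  refine (integral_pos_iff_support_of_nonneg_ae (hpos.mono fun z hz => hz.le)
    (hG.integrable hR 0)).2 ?_
  have h1 : (Q.prod (R : Measure (Weights K))) (Function.support (G 0)) = 1 :=
    (prob_compl_eq_zero_iff₀ ((hG.measurable 0).nullMeasurable
      (measurableSet_singleton (0 : ℝ)).compl)).1 (hpos.mono fun z hz => hz.ne')
  rw [h1]
  exact one_pos

theorem exists_integral_eq_zero (Q : Measure U) [IsProbabilityMeasure Q] (hR : Admissible R) :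
    ∃ s : ℝ, 0 < s ∧ ∫ z, G s z ∂(Q.prod (R : Measure (Weights K))) = 0 := by
  set f : ℝ → ℝ := fun d => ∫ z, G d z ∂(Q.prod (R : Measure (Weights K))) with hf
  have hcont : Continuous f := by
    refine (LipschitzWith.of_le_add_mul ⟨-Real.log M.A, (neg_pos.2 log_A_neg).le⟩
      fun d e => ?_).continuous
    change f d ≤ f e + -Real.log M.A * |d - e|
    rcases le_total d e with h | h
    · have := hG.integral_add_le (Q := Q) hR h
      rw [abs_of_nonpos (by linarith)]
      change f d + _ ≤ f e at this
      linarith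
    · have h1 : f d ≤ f e := hG.integral_anti hR h
      have := mul_nonneg (neg_pos.2 (log_A_neg (M := M))).le (abs_nonneg (d - e))
      linarith
  have h0 : 0 < f 0 := hG.integral_pos hR le_rfl
  have hB := log_B_neg (M := M)
  -- the slope is at most `log B`, so `f` has become nonpositive at `T`
  set T := f 0 / -Real.log M.B with hT
  have hT0 : 0 < T := div_pos h0 (neg_pos.2 hB)
  have hfT : f T ≤ 0 := by
    have h1 : f T ≤ f 0 + (T - 0) * Real.log M.B := hG.integral_le_add hR hT0.le
    have h2 : T * -Real.log M.B = f 0 := div_mul_cancel₀ _ (neg_pos.2 hB).ne'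
    linarith
  obtain ⟨s, ⟨hs0, -⟩, hs⟩ := intermediate_value_Icc' hT0.le hcont.continuousOn ⟨hfT, h0.le⟩
  refine ⟨s, hs0.lt_of_ne ?_, hs⟩
  rintro rfl
  linarith

theorem integral_single (Q : Measure U) [IsProbabilityMeasure Q] (d : ℝ) (p : Weights K) :
    ∫ z, G d z ∂(Q.prod (single p : Measure (Weights K))) = ∫ u, G d (u, p) ∂Q := by
  change ∫ z, G d z ∂(Q.prod (Measure.dirac p)) = _
  rw [Measure.prod_dirac, integral_map (by fun_prop) (hG.measurable d).aestronglyMeasurable]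

theorem integral_eq (hR : Admissible R) (d : ℝ) :
    ∫ z, G d z ∂(Q.prod (R : Measure (Weights K))) =
      ∫ p, ∫ z, G d z ∂(Q.prod (single p : Measure (Weights K))) ∂(R : Measure (Weights K)) := by
  rw [integral_prod_symm _ (hG.integrable hR d)]
  exact integral_congr_ae (ae_of_all _ fun p => (hG.integral_single Q d p).symm)

theorem integrable_integral_single (hR : Admissible R) (d : ℝ) :
    Integrable (fun p => ∫ z, G d z ∂(Q.prod (single p : Measure (Weights K))))
      (R : Measure (Weights K)) :=
  (hG.integrable (Q := Q) hR d).integral_prod_right.congr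
    (ae_of_all _ fun p => (hG.integral_single Q d p).symm)

/-- The mean score under `R` is the average over `p` of the mean scores under the single weight
vectors `p`, so some valid `p` does not exceed it. -/
theorem exists_single_le (hR : Admissible R) (d : ℝ) : ∃ p : Weights K, IsValid p ∧
    ∫ z, G d z ∂(Q.prod (single p : Measure (Weights K))) ≤
      ∫ z, G d z ∂(Q.prod (R : Measure (Weights K))) := by
  obtain ⟨p, hp, h⟩ := exists_notMem_null_le_integral
    (hG.integrable_integral_single (Q := Q) hR d) (ae_iff.1 hR.ae_pos)
  rw [← hG.integral_eq hR] at h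
  exact ⟨p, fun i => ((not_not.1 hp) i).ne', h⟩

theorem exists_le_single (hR : Admissible R) (d : ℝ) : ∃ p : Weights K, IsValid p ∧
    ∫ z, G d z ∂(Q.prod (R : Measure (Weights K))) ≤
      ∫ z, G d z ∂(Q.prod (single p : Measure (Weights K))) := by
  obtain ⟨p, hp, h⟩ := exists_notMem_null_integral_le
    (hG.integrable_integral_single (Q := Q) hR d) (ae_iff.1 hR.ae_pos)
  rw [← hG.integral_eq hR] at h
  exact ⟨p, fun i => ((not_not.1 hp) i).ne', h⟩

theorem integrable_single (Q : Measure U) [IsProbabilityMeasure Q] {p : Weights K}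
    (hp : IsValid p) (d : ℝ) : Integrable (fun u => G d (u, p)) Q := by
  have h := hG.integrable (Q := Q) hp.admissible_single d
  change Integrable (G d) (Q.prod (Measure.dirac p)) at h
  rw [Measure.prod_dirac] at h
  exact h.comp_measurable (by fun_prop)

theorem continuousOn_single (Q : Measure U) [IsProbabilityMeasure Q] (d : ℝ) :
    ContinuousOn (fun p : Weights K => ∫ z, G d z ∂(Q.prod (single p : Measure (Weights K))))
      {p | IsValid p} := by
  simp only [hG.integral_single]
  have key : ∀ p q : Weights K, IsValid p → IsValid q → ∫ u, G d (u, p) ∂Q ≤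
      ∫ u, G d (u, q) ∂Q + ∑ i, |Real.log (p.1 i) - Real.log (q.1 i)| := by
    intro p q hp hq
    have h1 := integral_mono (hG.integrable_single Q hp d) ((hG.integrable_single Q hq d).add
      (integrable_const (∑ i, |Real.log (p.1 i) - Real.log (q.1 i)|)))
      (fun u => hG.le_add_sum d u p q)
    have h2 := integral_add (hG.integrable_single Q hq d)
      (integrable_const (∑ i, |Real.log (p.1 i) - Real.log (q.1 i)|))
    rw [integral_const, probReal_univ, one_smul] at h2
    exact h1.trans h2.le
  intro q hq
  have hlog : ContinuousWithinAt (fun p : Weights K =>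
      ∑ i, |Real.log (p.1 i) - Real.log (q.1 i)|) {p | IsValid p} q := by
    refine ContinuousAt.continuousWithinAt ?_
    refine tendsto_finsetSum _ fun i _ => ?_
    have h1 : ContinuousAt (fun p : Weights K => p.1 i) q :=
      ((continuous_apply i).comp continuous_subtype_val).continuousAt
    exact ((h1.log (hq i)).sub continuousAt_const).abs
  have h0 : Tendsto (fun p : Weights K => ∑ i, |Real.log (p.1 i) - Real.log (q.1 i)|)
      (𝓝[{p | IsValid p}] q) (𝓝 0) := by
    simpa [ContinuousWithinAt] using hlog
  refine tendsto_iff_dist_tendsto_zero.2 (squeeze_zero' (Eventually.of_forall fun _ =>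
    dist_nonneg) ?_ h0)
  filter_upwards [self_mem_nhdsWithin] with p hp
  rw [Real.dist_eq, abs_le]
  have h1 := key p q hp hq
  have h2 := key q p hq hp
  simp only [abs_sub_comm (Real.log (q.1 _))] at h2
  constructor <;> linarith

/-- The intermediate value theorem on the simplex. -/
theorem exists_single_eq_zero (Q : Measure U) [IsProbabilityMeasure Q] (d : ℝ) {p q : Weights K}
    (hp : IsValid p) (hq : IsValid q)
    (hp0 : ∫ z, G d z ∂(Q.prod (single p : Measure (Weights K))) ≤ 0)
    (hq0 : 0 ≤ ∫ z, G d z ∂(Q.prod (single q : Measure (Weights K)))) :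
    ∃ r : Weights K, IsValid r ∧
      ∫ z, G d z ∂(Q.prod (single r : Measure (Weights K))) = 0 := by
  let γ : I → Weights K := fun θ => ⟨(1 - θ.1) • p.1 + θ.1 • q.1,
    convex_stdSimplex ℝ (Fin K) p.2 q.2 (by linarith [θ.2.2]) θ.2.1 (by ring)⟩
  have hγ : Continuous γ := by
    refine Continuous.subtype_mk ?_ _
    fun_prop
  have hγv : ∀ θ, IsValid (γ θ) := by
    intro θ i
    have h1 : (γ θ).1 i = (1 - θ.1) * p.1 i + θ.1 * q.1 i := by simp [γ]
    have h2 := hp.pos i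
    have h3 := hq.pos i
    have h4 := θ.2.1
    have h5 := θ.2.2
    rw [h1]
    rcases h4.eq_or_lt with h | h
    · rw [← h]
      simpa using h2.ne'
    · have : 0 ≤ (1 - θ.1) * p.1 i := mul_nonneg (by linarith) h2.le
      positivity
  have hc := (hG.continuousOn_single Q d).comp_continuous hγ hγv
  have e0 : γ 0 = p := by ext i; simp [γ]
  have e1 : γ 1 = q := by ext i; simp [γ]
  obtain ⟨θ, hθ⟩ := mem_range_of_exists_le_of_exists_ge (c := 0) hc
    ⟨0, by simpa only [Function.comp_apply, e0] using hp0⟩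
    ⟨1, by simpa only [Function.comp_apply, e1] using hq0⟩
  exact ⟨γ θ, hγv θ, hθ⟩

end IsExtremalScore

end IFSFamily

end RandomMoran

namespace RandomMoran

namespace IFSFamily

variable {U : Type*} [MeasurableSpace U] {K : ℕ} {M : IFSFamily U K}
  {Q : Measure U} [IsProbabilityMeasure Q] {R : ProbabilityMeasure (Weights K)}

/-! ### The almost sure dimensions as zeros of the mean extremal scores -/

theorem ae_weights_pos (Q : Measure U) [IsProbabilityMeasure Q] (hR : Admissible R) :
    ∀ᵐ l ∂(Measure.infinitePi fun _ : ℕ => Q.prod (R : Measure (Weights K))),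
      ∀ k i, 0 < (l k).2.1 i := by
  refine ae_all_iff.2 fun k => ?_
  exact (measurePreserving_eval_infinitePi (fun _ : ℕ => Q.prod (R : Measure (Weights K)))
    k).quasiMeasurePreserving.ae ((Measure.quasiMeasurePreserving_snd (μ := Q)).ae hR.ae_pos)

theorem ae_mem_upperExponents {Φ : ℝ → ℝ} (hΦ : IsLarge Φ) (hR : Admissible R) {d : ℝ}
    (hd : 0 ≤ d) (h : ∫ z, M.maxScore d z ∂(Q.prod (R : Measure (Weights K))) < 0) :
    ∀ᵐ l ∂(Measure.infinitePi fun _ : ℕ => Q.prod (R : Measure (Weights K))),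
      d ∈ upperExponents Φ (M.moranMeasure l) := by
  have hG := isExtremalScore_maxScore M
  obtain ⟨t, ht, hint⟩ := hG.exists_integrable_exp (Q := Q) hR d
  obtain ⟨ε, hε, L, hL, hae⟩ := exists_ae_window_sum_le (hG.measurable d) ht hint h
  filter_upwards [ae_weights_pos Q hR, hae] with l hl ⟨n₀, hn₀⟩
  refine mem_upperExponents hΦ hl hd hL ⟨n₀, fun n hn m hm ω => ?_⟩
  have hmn : (n : ℝ) ≤ m := by exact_mod_cast (Nat.le_add_right _ _).trans hm
  calc _ ≤ ∑ k ∈ Finset.Ico n m, M.maxScore d (l k) :=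
        Finset.sum_le_sum fun k _ => score_le_maxScore d (l k) (ω k)
    _ ≤ _ := hn₀ n hn m hm
    _ ≤ 0 := neg_nonpos.2 (mul_nonneg hε.le (sub_nonneg.2 hmn))

theorem ae_mem_lowerExponents {Φ : ℝ → ℝ} (hΦ : IsLarge Φ) (hR : Admissible R) {d : ℝ}
    (hd : 0 ≤ d) (h : 0 < ∫ z, M.minScore d z ∂(Q.prod (R : Measure (Weights K)))) :
    ∀ᵐ l ∂(Measure.infinitePi fun _ : ℕ => Q.prod (R : Measure (Weights K))),
      d ∈ lowerExponents Φ (M.moranMeasure l) := by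
  have hG := isExtremalScore_minScore M
  obtain ⟨t, ht, hint⟩ := hG.exists_integrable_exp (Q := Q) hR d
  obtain ⟨ε, hε, L, hL, hae⟩ := exists_ae_window_sum_le (Y := fun z => -M.minScore d z)
    (hG.measurable d).neg ht (by simpa only [abs_neg] using hint)
    (by rw [integral_neg]; exact neg_neg_of_pos h)
  filter_upwards [ae_weights_pos Q hR, hae] with l hl ⟨n₀, hn₀⟩
  refine mem_lowerExponents hΦ hl hd hL ⟨n₀, fun n hn m hm ω => ?_⟩
  have hmn : (n : ℝ) ≤ m := by exact_mod_cast (Nat.le_add_right _ _).trans hm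
  have h1 := hn₀ n hn m hm
  rw [Finset.sum_neg_distrib, neg_le_neg_iff] at h1
  calc 0 ≤ _ := mul_nonneg hε.le (sub_nonneg.2 hmn)
    _ ≤ ∑ k ∈ Finset.Ico n m, M.minScore d (l k) := h1
    _ ≤ _ := Finset.sum_le_sum fun k _ => minScore_le_score d (l k) (ω k)

/-- The exponent fails at the point whose address follows the largest scores. -/
theorem ae_notMem_upperExponents {Φ : ℝ → ℝ} (hΦ : ∀ t ∈ Ioo (0 : ℝ) 1, 0 ≤ Φ t)
    (hR : Admissible R) {d : ℝ}
    (h : 0 < ∫ z, M.maxScore d z ∂(Q.prod (R : Measure (Weights K)))) :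
    ∀ᵐ l ∂(Measure.infinitePi fun _ : ℕ => Q.prod (R : Measure (Weights K))),
      d ∉ upperExponents Φ (M.moranMeasure l) := by
  have hG := isExtremalScore_maxScore M
  obtain ⟨t, ht, hint⟩ := hG.exists_integrable_exp (Q := Q) hR d
  have hae := ae_sum_tendsto_atBot (Y := fun z => -M.maxScore d z)
    (hG.measurable d).neg ht (by simpa only [abs_neg] using hint)
    (by rw [integral_neg]; exact neg_neg_of_pos h)
  filter_upwards [ae_weights_pos Q hR, hae] with l hl hlim
  choose ω hω using fun k => exists_score_eq_maxScore (M := M) d (l k)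
  refine notMem_upperExponents hΦ hl ω ?_
  simp only [hω]
  simp only [Finset.sum_neg_distrib] at hlim
  exact tendsto_neg_atBot_iff.1 hlim

/-- The exponent fails at the point whose address follows the smallest scores. -/
theorem ae_notMem_lowerExponents {Φ : ℝ → ℝ} (hΦ : ∀ t ∈ Ioo (0 : ℝ) 1, 0 ≤ Φ t)
    (hR : Admissible R) {d : ℝ}
    (h : ∫ z, M.minScore d z ∂(Q.prod (R : Measure (Weights K))) < 0) :
    ∀ᵐ l ∂(Measure.infinitePi fun _ : ℕ => Q.prod (R : Measure (Weights K))),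
      d ∉ lowerExponents Φ (M.moranMeasure l) := by
  have hG := isExtremalScore_minScore M
  obtain ⟨t, ht, hint⟩ := hG.exists_integrable_exp (Q := Q) hR d
  filter_upwards [ae_weights_pos Q hR, ae_sum_tendsto_atBot (hG.measurable d) ht hint h]
    with l hl hlim
  choose ω hω using fun k => exists_score_eq_minScore (M := M) d (l k)
  refine notMem_lowerExponents hΦ hl ω ?_
  simpa only [hω] using hlim

theorem tendsto_add_one_div (s c : ℝ) :
    Tendsto (fun n : ℕ => s + c * (1 / ((n : ℝ) + 1))) atTop (𝓝 s) := by
  simpa using (tendsto_one_div_add_atTop_nhds_zero_nat (𝕜 := ℝ)).const_mul c |>.const_add s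

theorem mul_one_div_mem (n : ℕ) {s : ℝ} (hs : 0 < s) :
    0 < s * (1 / ((n : ℝ) + 1)) ∧ s * (1 / ((n : ℝ) + 1)) ≤ s := by
  refine ⟨by positivity, mul_le_of_le_one_right hs.le ?_⟩
  rw [div_le_one (by positivity)]
  linarith [Nat.cast_nonneg (α := ℝ) n]

theorem isUpperDim_of_integral_eq_zero {Φ : ℝ → ℝ} (hΦ : IsDimensionFunction Φ)
    (hlarge : IsLarge Φ) (hR : Admissible R) {s : ℝ} (hs : 0 < s)
    (h : ∫ z, M.maxScore s z ∂(Q.prod (R : Measure (Weights K))) = 0) :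
    M.IsUpperDim Q Φ R s := by
  have hG := isExtremalScore_maxScore M
  have h1 : ∀ n : ℕ, ∀ᵐ l ∂(Measure.infinitePi fun _ : ℕ => Q.prod (R : Measure (Weights K))),
      s + s * (1 / ((n : ℝ) + 1)) ∈ upperExponents Φ (M.moranMeasure l) := by
    intro n
    have := mul_one_div_mem n hs
    refine ae_mem_upperExponents hlarge hR (by linarith) ?_
    exact (hG.integral_strictAnti hR (by linarith)).trans_le h.le
  have h2 : ∀ n : ℕ, ∀ᵐ l ∂(Measure.infinitePi fun _ : ℕ => Q.prod (R : Measure (Weights K))),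
      s + -s * (1 / ((n : ℝ) + 1)) ∉ upperExponents Φ (M.moranMeasure l) := by
    intro n
    have := mul_one_div_mem n hs
    refine ae_notMem_upperExponents hΦ.nonneg hR ?_
    exact h.symm.le.trans_lt (hG.integral_strictAnti hR (by linarith))
  filter_upwards [ae_all_iff.2 h1, ae_all_iff.2 h2] with l hl1 hl2
  exact upperPhiDim_eq (tendsto_add_one_div s s) (tendsto_add_one_div s (-s)) hl1 hl2

theorem isLowerDim_of_integral_eq_zero {Φ : ℝ → ℝ} (hΦ : IsDimensionFunction Φ)
    (hlarge : IsLarge Φ) (hR : Admissible R) {s : ℝ} (hs : 0 < s)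
    (h : ∫ z, M.minScore s z ∂(Q.prod (R : Measure (Weights K))) = 0) :
    M.IsLowerDim Q Φ R s := by
  have hG := isExtremalScore_minScore M
  have h1 : ∀ n : ℕ, ∀ᵐ l ∂(Measure.infinitePi fun _ : ℕ => Q.prod (R : Measure (Weights K))),
      s + -s * (1 / ((n : ℝ) + 1)) ∈ lowerExponents Φ (M.moranMeasure l) := by
    intro n
    have := mul_one_div_mem n hs
    refine ae_mem_lowerExponents hlarge hR (by linarith) ?_
    exact h.symm.le.trans_lt (hG.integral_strictAnti hR (by linarith))
  have h2 : ∀ n : ℕ, ∀ᵐ l ∂(Measure.infinitePi fun _ : ℕ => Q.prod (R : Measure (Weights K))),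
      s + s * (1 / ((n : ℝ) + 1)) ∉ lowerExponents Φ (M.moranMeasure l) := by
    intro n
    have := mul_one_div_mem n hs
    refine ae_notMem_lowerExponents hΦ.nonneg hR ?_
    exact (hG.integral_strictAnti hR (by linarith)).trans_le h.le
  filter_upwards [ae_all_iff.2 h1, ae_all_iff.2 h2] with l hl1 hl2
  exact lowerPhiDim_eq (tendsto_add_one_div s (-s)) (tendsto_add_one_div s s) hl1 hl2

/-- Every attainable upper dimension is the positive real zero of a mean largest score. -/
theorem mem_upperDims_iff {Φ : ℝ → ℝ} (hΦ : IsDimensionFunction Φ) (hlarge : IsLarge Φ)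
    {x : EReal} : x ∈ M.upperDims Q Φ ↔ ∃ R : ProbabilityMeasure (Weights K), Admissible R ∧
      ∃ s : ℝ, 0 < s ∧ ∫ z, M.maxScore s z ∂(Q.prod (R : Measure (Weights K))) = 0 ∧
        x = s := by
  constructor
  · rintro ⟨R, hR, hx⟩
    obtain ⟨s, hs, h⟩ := (isExtremalScore_maxScore M).exists_integral_eq_zero Q hR
    refine ⟨R, hR, s, hs, h, ?_⟩
    obtain ⟨l, h1, h2⟩ := (hx.and (isUpperDim_of_integral_eq_zero hΦ hlarge hR hs h)).exists
    exact h1.symm.trans h2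
  · rintro ⟨R, hR, s, hs, h, rfl⟩
    exact ⟨R, hR, isUpperDim_of_integral_eq_zero hΦ hlarge hR hs h⟩

/-- Every attainable lower dimension is the positive real zero of a mean smallest score. -/
theorem mem_lowerDims_iff {Φ : ℝ → ℝ} (hΦ : IsDimensionFunction Φ) (hlarge : IsLarge Φ)
    {x : EReal} : x ∈ M.lowerDims Q Φ ↔ ∃ R : ProbabilityMeasure (Weights K), Admissible R ∧
      ∃ s : ℝ, 0 < s ∧ ∫ z, M.minScore s z ∂(Q.prod (R : Measure (Weights K))) = 0 ∧
        x = s := by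
  constructor
  · rintro ⟨R, hR, hx⟩
    obtain ⟨s, hs, h⟩ := (isExtremalScore_minScore M).exists_integral_eq_zero Q hR
    refine ⟨R, hR, s, hs, h, ?_⟩
    obtain ⟨l, h1, h2⟩ := (hx.and (isLowerDim_of_integral_eq_zero hΦ hlarge hR hs h)).exists
    exact h1.symm.trans h2
  · rintro ⟨R, hR, s, hs, h, rfl⟩
    exact ⟨R, hR, isLowerDim_of_integral_eq_zero hΦ hlarge hR hs h⟩

/-! ### Attaining the dimensions with single weight vectors -/

/-- There are valid weight vectors arbitrarily close to a given vertex of the simplex. -/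
theorem exists_isValid_near_vertex (i : Fin K) {c : ℝ} (hc : 0 < c) (hc1 : c < 1) :
    ∃ q : Weights K, IsValid q ∧ 1 - c ≤ q.1 i := by
  have hK : (0 : ℝ) < K := by exact_mod_cast i.pos
  refine ⟨⟨fun j => (if j = i then 1 - c else 0) + c / K, fun j => ?_, ?_⟩, fun j => ?_, ?_⟩
  · have : 0 ≤ if j = i then 1 - c else 0 := by split_ifs <;> linarith
    positivity
  · rw [Finset.sum_add_distrib]
    simp
    field_simp
    ring
  · have : 0 ≤ if j = i then 1 - c else 0 := by split_ifs <;> linarith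
    exact (show 0 < (if j = i then 1 - c else 0) + c / K by positivity).ne'
  · simp only [if_true, le_add_iff_nonneg_right]
    positivity

theorem isCompact_weights_ge (δ : ℝ) : IsCompact {p : Weights K | ∀ i, δ ≤ p.1 i} := by
  refine IsClosed.isCompact ?_
  simp only [ofPred_forall]
  exact isClosed_iInter fun i => isClosed_le continuous_const
    ((continuous_apply i).comp continuous_subtype_val)

/-- A weight at most `A ^ t` makes the largest score at exponent `t` nonnegative for every
system. -/
theorem exists_maxScore_nonneg (M : IFSFamily U K) (Q : Measure U) [IsProbabilityMeasure Q]
    {t : ℝ} (ht : 0 < t) : ∃ q : Weights K, IsValid q ∧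
      0 ≤ ∫ z, M.maxScore t z ∂(Q.prod (single q : Measure (Weights K))) := by
  have : Nontrivial (Fin K) := Fin.nontrivial_iff_two_le.2 M.two_le
  obtain ⟨i, j, hij⟩ := exists_pair_ne (Fin K)
  obtain ⟨q, hq, hqi⟩ := exists_isValid_near_vertex i (Real.rpow_pos_of_pos M.A_pos t)
    (Real.rpow_lt_one M.A_pos.le A_lt_one ht)
  refine ⟨q, hq, ?_⟩
  rw [(isExtremalScore_maxScore M).integral_single]
  refine integral_nonneg fun u => le_trans ?_ (score_le_maxScore t (u, q) j)
  have h1 := Finset.add_le_sum (fun k _ => q.2.1 k) (Finset.mem_univ i) (Finset.mem_univ j) hij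
  rw [q.2.2] at h1
  have h2 : Real.log (q.1 j) ≤ t * Real.log M.A := by
    rw [← Real.log_rpow M.A_pos]
    exact Real.log_le_log (hq.pos j) (by linarith)
  have h3 := mul_le_mul_of_nonneg_left (log_A_le (M := M) j u) ht.le
  simp only [score, Pi.zero_apply]
  linarith

/-- A weight at least `B ^ t` makes the smallest score at exponent `t` nonpositive for every
system. -/
theorem exists_minScore_nonpos (M : IFSFamily U K) (Q : Measure U) [IsProbabilityMeasure Q]
    {t : ℝ} (ht : 0 < t) : ∃ q : Weights K, IsValid q ∧
      ∫ z, M.minScore t z ∂(Q.prod (single q : Measure (Weights K))) ≤ 0 := by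
  obtain ⟨i⟩ := nonempty_fin M
  have hB := B_pos (M := M)
  have h0 := Real.rpow_lt_one hB.le M.B_lt_one ht
  have h0' := Real.rpow_pos_of_pos hB t
  obtain ⟨q, hq, hqi⟩ := exists_isValid_near_vertex i (c := 1 - M.B ^ t) (by linarith)
    (by linarith)
  refine ⟨q, hq, ?_⟩
  rw [(isExtremalScore_minScore M).integral_single]
  refine integral_nonpos fun u => (minScore_le_score t (u, q) i).trans ?_
  have h2 : t * Real.log M.B ≤ Real.log (q.1 i) := by
    rw [← Real.log_rpow hB]
    exact Real.log_le_log h0' (by linarith)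
  have h3 := mul_le_mul_of_nonneg_left (log_a_le (M := M) i u) ht.le
  simp only [score, Pi.zero_apply]
  linarith

/-- The infimum of the attainable upper dimensions is controlled by a single weight vector. By
averaging, weight vectors exist for all larger exponents; their weights are bounded below, since
a small weight makes the largest score large, so that compactness applies. -/
theorem exists_maxScore_nonpos {Φ : ℝ → ℝ} (hΦ : IsDimensionFunction Φ) (hlarge : IsLarge Φ)
    {t : ℝ} (ht : sInf (M.upperDims Q Φ) ≤ t) : ∃ p : Weights K, IsValid p ∧
      ∫ z, M.maxScore t z ∂(Q.prod (single p : Measure (Weights K))) ≤ 0 := by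
  have hG := isExtremalScore_maxScore M
  have key : ∀ ε ∈ Ioc (0 : ℝ) 1, ∃ p : Weights K, (∀ i, M.A ^ (t + 1) ≤ p.1 i) ∧
      ∫ z, M.maxScore t z ∂(Q.prod (single p : Measure (Weights K))) ≤ ε * -Real.log M.A := by
    intro ε hε
    have h1 : sInf (M.upperDims Q Φ) < ((t + ε : ℝ) : EReal) :=
      ht.trans_lt (EReal.coe_lt_coe_iff.2 (by linarith [hε.1]))
    obtain ⟨x, hx, hxt⟩ := sInf_lt_iff.1 h1
    obtain ⟨R, hR, s, hs, h0, rfl⟩ := (mem_upperDims_iff hΦ hlarge).1 hx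
    have hst : s < t + ε := EReal.coe_lt_coe_iff.1 hxt
    obtain ⟨p, hp, hp0⟩ := hG.exists_single_le (Q := Q) hR s
    rw [h0] at hp0
    refine ⟨p, fun i => ?_, ?_⟩
    · rw [hG.integral_single] at hp0
      have h2 : ∫ _, s * Real.log M.A - Real.log (p.1 i) ∂Q ≤ ∫ u, M.maxScore s (u, p) ∂Q := by
        refine integral_mono (integrable_const _) (hG.integrable_single Q hp s) fun u => ?_
        refine le_trans ?_ (score_le_maxScore s (u, p) i)
        have := mul_le_mul_of_nonneg_left (log_A_le (M := M) i u) hs.le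
        simp only [score]
        linarith
      rw [integral_const, probReal_univ, one_smul] at h2
      rw [← Real.log_le_log_iff (Real.rpow_pos_of_pos M.A_pos _) (hp.pos i),
        Real.log_rpow M.A_pos]
      have h3 : (t + 1) * Real.log M.A ≤ s * Real.log M.A :=
        mul_le_mul_of_nonpos_right (by linarith [hε.2]) log_A_neg.le
      linarith
    · have h2 := hG.integral_add_le (Q := Q) hp.admissible_single
        (show t ≤ t + ε by linarith [hε.1])
      have h3 := hG.integral_anti (Q := Q) hp.admissible_single hst.le
      linarith
  have hpos : ∀ p : Weights K, (∀ i, M.A ^ (t + 1) ≤ p.1 i) → IsValid p := fun p hp i =>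
    ((Real.rpow_pos_of_pos M.A_pos _).trans_le (hp i)).ne'
  obtain ⟨p₁, hp₁, -⟩ := key 1 ⟨one_pos, le_rfl⟩
  obtain ⟨p, hp, hmin⟩ := (isCompact_weights_ge (K := K) (M.A ^ (t + 1))).exists_isMinOn ⟨p₁, hp₁⟩
    ((hG.continuousOn_single Q t).mono hpos)
  refine ⟨p, hpos p hp, ?_⟩
  have hA := neg_pos.2 (log_A_neg (M := M))
  by_contra! hlt
  set v := ∫ z, M.maxScore t z ∂(Q.prod (single p : Measure (Weights K))) with hv
  obtain ⟨q, hq, hq0⟩ := key (min 1 (v / (2 * -Real.log M.A))) ⟨by positivity, min_le_left _ _⟩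
  have h1 : v ≤ _ := hmin hq
  have h2 : min 1 (v / (2 * -Real.log M.A)) * -Real.log M.A ≤
      v / (2 * -Real.log M.A) * -Real.log M.A :=
    mul_le_mul_of_nonneg_right (min_le_right _ _) hA.le
  have h3 : v / (2 * -Real.log M.A) * -Real.log M.A = v / 2 := by
    rw [← div_div, div_mul_cancel₀ _ hA.ne']
  linarith

theorem exists_inv_le_weight (M : IFSFamily U K) (p : Weights K) :
    ∃ i, (K : ℝ)⁻¹ ≤ p.1 i := by
  by_contra! h
  obtain ⟨i⟩ := nonempty_fin M
  have h1 : ∑ i, p.1 i < ∑ _i : Fin K, (K : ℝ)⁻¹ :=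
    Finset.sum_lt_sum_of_nonempty ⟨i, Finset.mem_univ i⟩ fun i _ => h i
  have hK : (K : ℝ) ≠ 0 := by exact_mod_cast i.pos.ne'
  rw [p.2.2] at h1
  simp [hK] at h1

theorem minScore_le {d : ℝ} (hd : 0 ≤ d) (u : U) (p : Weights K) :
    M.minScore d (u, p) ≤ d * Real.log M.B + Real.log K := by
  obtain ⟨i, hi⟩ := exists_inv_le_weight M p
  have hK : (0 : ℝ) < K := by exact_mod_cast i.pos
  refine (minScore_le_score d _ i).trans ?_
  have h1 := Real.log_le_log (inv_pos.2 hK) hi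
  rw [Real.log_inv] at h1
  have h2 := mul_le_mul_of_nonneg_left (log_a_le (M := M) i u) hd
  simp only [score]
  linarith

/-- Raising small weights to a fixed threshold and normalising does not decrease the smallest
score: the other weights shrink, and the score of a small weight exceeds `log K`, which bounds
the smallest score. -/
theorem exists_minScore_le_of_weights_ge (M : IFSFamily U K) {t : ℝ} (ht : 0 ≤ t)
    (p : Weights K) : ∃ q : Weights K, (∀ i, M.A ^ t / (2 * K) ≤ q.1 i) ∧
      ∀ d ∈ Icc 0 t, ∀ u, M.minScore d (u, p) ≤ M.minScore d (u, q) := by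
  obtain ⟨i₀⟩ := nonempty_fin M
  have hK : (0 : ℝ) < K := by exact_mod_cast i₀.pos
  have hAt := Real.rpow_pos_of_pos M.A_pos t
  -- the threshold at which a score at any exponent in `[0, t]` reaches `log K`
  set e := M.A ^ t / K with he
  have he0 : 0 < e := by positivity
  set S := ∑ i, max (p.1 i) e with hS
  have hS1 : 1 ≤ S := by
    rw [← p.2.2]
    exact Finset.sum_le_sum fun i _ => le_max_left _ _
  have hS2 : S ≤ 2 := by
    calc S ≤ ∑ i, (p.1 i + e) :=
          Finset.sum_le_sum fun i _ => max_le (by linarith) (by linarith [p.2.1 i])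
      _ = 1 + M.A ^ t := by
          rw [Finset.sum_add_distrib, p.2.2, Finset.sum_const, Finset.card_univ, Fintype.card_fin,
            nsmul_eq_mul, he]
          field_simp
      _ ≤ 2 := by linarith [Real.rpow_le_one M.A_pos.le A_lt_one.le ht]
  have hS0 : 0 < S := by linarith
  refine ⟨⟨fun i => max (p.1 i) e / S, fun i => by positivity, ?_⟩, fun i => ?_, ?_⟩
  · rw [← Finset.sum_div, div_self hS0.ne']
  · calc M.A ^ t / (2 * K) = e / 2 := by rw [he]; field_simp
      _ ≤ max (p.1 i) e / S := div_le_div₀ (by positivity) (le_max_right _ _) hS0 hS2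
  · intro d hd u
    obtain ⟨i, hi⟩ := exists_score_eq_minScore (M := M) d
      (u, ⟨fun i => max (p.1 i) e / S, fun i => by positivity,
        by rw [← Finset.sum_div, div_self hS0.ne']⟩)
    rw [← hi]
    have hle : max (p.1 i) e / S ≤ max (p.1 i) e := div_le_self (by positivity) hS1
    have hpos : 0 < max (p.1 i) e / S := by positivity
    rcases le_total e (p.1 i) with h | h
    · refine (minScore_le_score d _ i).trans ?_
      rw [max_eq_left h] at hle hpos
      have := Real.log_le_log hpos hle
      simp only [score, max_eq_left h]
      linarith
    · refine (minScore_le hd.1 u p).trans ?_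
      rw [max_eq_right h] at hle hpos
      have h1 := Real.log_le_log hpos hle
      rw [he, Real.log_div hAt.ne' hK.ne', Real.log_rpow M.A_pos, ← he] at h1
      have h2 := mul_le_mul_of_nonneg_left (log_A_le (M := M) i u) hd.1
      have h3 : t * Real.log M.A ≤ d * Real.log M.A :=
        mul_le_mul_of_nonpos_right hd.2 log_A_neg.le
      have h4 : d * Real.log M.B ≤ 0 := mul_nonpos_of_nonneg_of_nonpos hd.1 log_B_neg.le
      simp only [score, max_eq_right h]
      linarith

/-- The supremum of the attainable lower dimensions is controlled by a single weight vector. By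
averaging, weight vectors exist for all smaller exponents, and they may be chosen in a fixed
compact set of valid weight vectors. -/
theorem exists_minScore_nonneg {Φ : ℝ → ℝ} (hΦ : IsDimensionFunction Φ) (hlarge : IsLarge Φ)
    {t : ℝ} (ht0 : 0 < t) (ht : (t : EReal) ≤ sSup (M.lowerDims Q Φ)) :
    ∃ p : Weights K, IsValid p ∧
      0 ≤ ∫ z, M.minScore t z ∂(Q.prod (single p : Measure (Weights K))) := by
  have hG := isExtremalScore_minScore M
  have hK : (0 : ℝ) < K := by exact_mod_cast (show 0 < K by have := M.two_le; omega)
  have hδ : 0 < M.A ^ t / (2 * K) := by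
    have := Real.rpow_pos_of_pos M.A_pos t
    positivity
  set δ := M.A ^ t / (2 * K) with hδd
  have hpos : ∀ p : Weights K, (∀ i, δ ≤ p.1 i) → IsValid p := fun p hp i =>
    (hδ.trans_le (hp i)).ne'
  have key : ∀ ε ∈ Ioc 0 t, ∃ p : Weights K, (∀ i, δ ≤ p.1 i) ∧
      ε * Real.log M.A ≤ ∫ z, M.minScore t z ∂(Q.prod (single p : Measure (Weights K))) := by
    intro ε hε
    have h1 : ((t - ε : ℝ) : EReal) < sSup (M.lowerDims Q Φ) :=
      (EReal.coe_lt_coe_iff.2 (by linarith [hε.1])).trans_le ht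
    obtain ⟨x, hx, hxt⟩ := lt_sSup_iff.1 h1
    obtain ⟨R, hR, s, hs, h0, rfl⟩ := (mem_lowerDims_iff hΦ hlarge).1 hx
    have hst : t - ε < s := EReal.coe_lt_coe_iff.1 hxt
    obtain ⟨p, hp, hp0⟩ := hG.exists_le_single (Q := Q) hR s
    rw [h0] at hp0
    obtain ⟨q, hq, hpq⟩ := exists_minScore_le_of_weights_ge M ht0.le p
    refine ⟨q, hq, ?_⟩
    have h2 := hG.integral_anti (Q := Q) hp.admissible_single hst.le
    have h3 := hG.integral_add_le (Q := Q) (hpos q hq).admissible_single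
      (show t - ε ≤ t by linarith [hε.1])
    have h4 := integral_mono (hG.integrable_single Q hp (t - ε))
      (hG.integrable_single Q (hpos q hq) (t - ε))
      (hpq (t - ε) ⟨by linarith [hε.2], by linarith [hε.1]⟩)
    rw [← hG.integral_single, ← hG.integral_single] at h4
    linarith
  obtain ⟨p₁, hp₁, -⟩ := key t ⟨ht0, le_rfl⟩
  obtain ⟨p, hp, hmax⟩ := (isCompact_weights_ge (K := K) δ).exists_isMaxOn ⟨p₁, hp₁⟩
    ((hG.continuousOn_single Q t).mono hpos)
  refine ⟨p, hpos p hp, ?_⟩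
  have hA := neg_pos.2 (log_A_neg (M := M))
  by_contra! hlt
  set v := ∫ z, M.minScore t z ∂(Q.prod (single p : Measure (Weights K))) with hv
  have hv0 : 0 < -v := neg_pos.2 hlt
  obtain ⟨q, hq, hq0⟩ := key (min t (-v / (2 * -Real.log M.A))) ⟨by positivity, min_le_left _ _⟩
  have h1 : _ ≤ v := hmax hq
  have h2 : min t (-v / (2 * -Real.log M.A)) * -Real.log M.A ≤
      -v / (2 * -Real.log M.A) * -Real.log M.A :=
    mul_le_mul_of_nonneg_right (min_le_right _ _) hA.le
  have h3 : -v / (2 * -Real.log M.A) * -Real.log M.A = -v / 2 := by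
    rw [← div_div, div_mul_cancel₀ _ hA.ne']
  linarith

/-- The mean largest score at exponent `t` is nonpositive at the weight vector attaining the infimum
and nonnegative near a vertex of the simplex, so it vanishes somewhere in between. -/
theorem exists_isUpperDim_single {Φ : ℝ → ℝ} (hΦ : IsDimensionFunction Φ) (hlarge : IsLarge Φ)
    {t : ℝ} (ht : sInf (M.upperDims Q Φ) ≤ t) :
    ∃ p : Weights K, IsValid p ∧ M.IsUpperDim Q Φ (single p) t := by
  have hG := isExtremalScore_maxScore M
  obtain ⟨p, hp, hp0⟩ := exists_maxScore_nonpos hΦ hlarge ht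
  have ht0 : 0 < t := by
    by_contra! hneg
    exact absurd (hG.integral_pos (Q := Q) hp.admissible_single hneg) (not_lt.2 hp0)
  obtain ⟨q, hq, hq0⟩ := exists_maxScore_nonneg M Q ht0
  obtain ⟨r, hr, hr0⟩ := hG.exists_single_eq_zero Q t hp hq hp0 hq0
  exact ⟨r, hr, isUpperDim_of_integral_eq_zero hΦ hlarge hr.admissible_single ht0 hr0⟩

theorem exists_isLowerDim_single {Φ : ℝ → ℝ} (hΦ : IsDimensionFunction Φ) (hlarge : IsLarge Φ)
    {t : ℝ} (ht0 : 0 < t) (ht : (t : EReal) ≤ sSup (M.lowerDims Q Φ)) :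
    ∃ p : Weights K, IsValid p ∧ M.IsLowerDim Q Φ (single p) t := by
  obtain ⟨p, hp, hp0⟩ := exists_minScore_nonneg hΦ hlarge ht0 ht
  obtain ⟨q, hq, hq0⟩ := exists_minScore_nonpos M Q ht0
  obtain ⟨r, hr, hr0⟩ := (isExtremalScore_minScore M).exists_single_eq_zero Q t hq hp hq0 hp0
  exact ⟨r, hr, isLowerDim_of_integral_eq_zero hΦ hlarge hr.admissible_single ht0 hr0⟩

/-- Some weight is at least `1 / K`, so the smallest score at exponent `d` is at most
`d * log B + log K`, which bounds the lower dimensions. -/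
theorem sSup_lowerDims_lt_top {Φ : ℝ → ℝ} (hΦ : IsDimensionFunction Φ) (hlarge : IsLarge Φ) :
    sSup (M.lowerDims Q Φ) < ⊤ := by
  have hG := isExtremalScore_minScore M
  refine lt_of_le_of_lt (sSup_le ?_) (EReal.coe_lt_top (Real.log K / -Real.log M.B))
  intro x hx
  obtain ⟨R, hR, s, hs, h0, rfl⟩ := (mem_lowerDims_iff hΦ hlarge).1 hx
  obtain ⟨p, hp, hp0⟩ := hG.exists_le_single (Q := Q) hR s
  rw [h0, hG.integral_single] at hp0
  have h1 := integral_mono (hG.integrable_single Q hp s)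
    (integrable_const (s * Real.log M.B + Real.log K)) fun u => minScore_le hs.le u p
  rw [integral_const, probReal_univ, one_smul] at h1
  rw [EReal.coe_le_coe_iff, le_div_iff₀ (neg_pos.2 log_B_neg)]
  linarith

end IFSFamily

end RandomMoran

theorem mainTheorem6 {U : Type*} [MeasurableSpace U] {K : ℕ}
    (M : RandomMoran.IFSFamily U K) (Q : Measure U) [IsProbabilityMeasure Q]
    (Φ : ℝ → ℝ) (hΦ : RandomMoran.IsDimensionFunction Φ) (hlarge : RandomMoran.IsLarge Φ) :
    -- the almost sure dimensions exist, so that `d` and `d'` are meaningful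
    (∀ R : ProbabilityMeasure (RandomMoran.Weights K), RandomMoran.Admissible R →
      (∃ s : EReal, M.IsUpperDim Q Φ R s) ∧ (∃ s : EReal, M.IsLowerDim Q Φ R s)) ∧
    -- every `t ∈ [d, ∞)` and every `t' ∈ (0, d']` comes from a single valid weight vector
    (∀ t : ℝ, sInf (M.upperDims Q Φ) ≤ (t : EReal) →
      ∃ p : RandomMoran.Weights K, RandomMoran.IsValid p ∧
        M.IsUpperDim Q Φ (RandomMoran.single p) (t : EReal)) ∧
    (∀ t' : ℝ, 0 < t' → (t' : EReal) ≤ sSup (M.lowerDims Q Φ) →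
      ∃ p : RandomMoran.Weights K, RandomMoran.IsValid p ∧
        M.IsLowerDim Q Φ (RandomMoran.single p) (t' : EReal)) ∧
    -- the attainable sets are the intervals `[d, ∞)` and `(0, d']`, where `d' < ∞`
    sSup (M.lowerDims Q Φ) < ⊤ ∧
    M.upperDims Q Φ = Set.Ico (sInf (M.upperDims Q Φ)) ⊤ ∧
    M.lowerDims Q Φ = Set.Ioc 0 (sSup (M.lowerDims Q Φ)) := by

  have hattU := fun t ht => RandomMoran.IFSFamily.exists_isUpperDim_single (M := M) (Q := Q)
    (t := t) hΦ hlarge ht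
  have hattL := fun t ht0 ht => RandomMoran.IFSFamily.exists_isLowerDim_single (M := M) (Q := Q)
    (t := t) hΦ hlarge ht0 ht
  have htop := RandomMoran.IFSFamily.sSup_lowerDims_lt_top (M := M) (Q := Q) hΦ hlarge
  refine ⟨fun R hR => ⟨?_, ?_⟩, hattU, hattL, htop, ?_, ?_⟩
  · obtain ⟨s, hs, h⟩ :=
      (RandomMoran.IFSFamily.isExtremalScore_maxScore M).exists_integral_eq_zero Q hR
    exact ⟨s, RandomMoran.IFSFamily.isUpperDim_of_integral_eq_zero hΦ hlarge hR hs h⟩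
  · obtain ⟨s, hs, h⟩ :=
      (RandomMoran.IFSFamily.isExtremalScore_minScore M).exists_integral_eq_zero Q hR
    exact ⟨s, RandomMoran.IFSFamily.isLowerDim_of_integral_eq_zero hΦ hlarge hR hs h⟩
  · ext x
    constructor
    · intro hx
      refine ⟨sInf_le hx, ?_⟩
      obtain ⟨R, hR, s, hs, h, rfl⟩ := (RandomMoran.IFSFamily.mem_upperDims_iff hΦ hlarge).1 hx
      exact EReal.coe_lt_top s
    · rintro ⟨hx, hx'⟩
      have h0 : 0 ≤ sInf (M.upperDims Q Φ) := le_sInf fun y hy => by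
        obtain ⟨R, hR, s, hs, h, rfl⟩ := (RandomMoran.IFSFamily.mem_upperDims_iff hΦ hlarge).1 hy
        exact EReal.coe_nonneg.2 hs.le
      lift x to ℝ using ⟨hx'.ne, ((EReal.bot_lt_zero).trans_le (h0.trans hx)).ne'⟩
      obtain ⟨p, hp, h⟩ := hattU x hx
      exact ⟨_, hp.admissible_single, h⟩
  · ext x
    constructor
    · intro hx
      refine ⟨?_, le_sSup hx⟩
      obtain ⟨R, hR, s, hs, h, rfl⟩ := (RandomMoran.IFSFamily.mem_lowerDims_iff hΦ hlarge).1 hx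
      exact EReal.coe_pos.2 hs
    · rintro ⟨hx, hx'⟩
      lift x to ℝ using ⟨(hx'.trans_lt htop).ne, (EReal.bot_lt_zero.trans hx).ne'⟩
      obtain ⟨p, hp, h⟩ := hattL x (EReal.coe_pos.1 hx) hx'
      exact ⟨_, hp.admissible_single, h⟩
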